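/- Let $d\ge 1$ and let $S:\mathbb R^d\times\mathbb R^d\to\mathbb R$ be a generating function, that is, a $C^2$ function such that $S(x+r,y+r)=S(x,y)$ for all $r\in\mathbb Z^d$ and all $x,y$, and such that for some $A>0$ $$\sum_{i,j}\frac{\partial^2 S}{\partial x_i\partial y_j}(x,y)\,\xi_i\xi_j\le -A\|\xi\|^2\qquad\text{for all }x,y,\xi\in\mathbb R^d .$$ Let $\overline F:\mathbb R^d\times(\mathbb R^d)^*\to\mathbb R^d\times(\mathbb R^d)^*$ be the twist map generated by $S$, i.e. the diffeomorphism with $\overline F(x,p)=(x',p')$ if and only if $p=-\partial_1S(x,x')$ and $p'=\partial_2S(x,x')$; it is the lift of a diffeomorphism $F$ of $T^*\mathbb T^d$, where $\mathbb T^d=\mathbb R^d/\mathbb Z^d$. Assume that $F$ is without conjugate points: with $V=\{0\}\times(\mathbb R^d)^*$ the vertical space, $V\cap D\overline F^{\,n}(x,p)V=\{0\}$ for every $(x,p)$ and every integer $n\ne 0$. For a cohomology class $c\in(\mathbb R^d)^*\cong H^1(\mathbb T^d,\mathbb R)$ put $S_c(x,y)=S(x,y)+c(x-y)$ and $S_c(x_0,\dots,x_n)=\sum_{k=0}^{n-1}S_c(x_k,x_{k+1})$,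 and let $$\widetilde S_c=\inf_{(x_k)_{k\in\mathbb N}}\ \liminf_{n\to\infty}\tfrac1n S_c(x_0,\dots,x_n),\qquad \widetilde S_c(x_0,\dots,x_n)=S_c(x_0,\dots,x_n)-n\widetilde S_c,$$ where the infimum is over all sequences in $\mathbb R^d$. The Mañé potential is $$\varphi_c(x,y)=\inf\{\widetilde S_c(x_0,\dots,x_n): n\ge1,\ x_0,\dots,x_n\in\mathbb R^d,\ x_0=x,\ x_n-y\in\mathbb Z^d\},$$ and the Aubry set $\overline{\mathcal A}_c$ is the set of all $(x,y)\in\mathbb R^d\times\mathbb R^d$ such that for every $\varepsilon>0$ there are $n\ge1$ and $x_0,\dots,x_n\in\mathbb R^d$ with $x_n-x_0\in\mathbb Z^d$, $\|x-x_0\|<\varepsilon$, $\|y-x_1\|<\varepsilon$ and $\widetilde S_c(x_0,\dots,x_n)<\varepsilon$. Then, for every $c\in(\mathbb R^d)^*$, the infima defining $\widetilde S_c$ and $\varphi_c(x,y)$ (for all $x,y$) are finite; the Aubry set projects onto the whole space, $\mathrm{pr}_1(\overline{\mathcal A}_c)=\mathbb R^d$; and $\varphi_c$ is additive and antisymmetric: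 $$\varphi_c(x,z)=\varphi_c(x,y)+\varphi_c(y,z)\quad\text{and}\quad \varphi_c(x,y)+\varphi_c(y,x)=0\qquad\text{for all }x,y,z\in\mathbb R^d .$$ -/

import Mathlib

namespace TwistMap

/-- `ℝ^d` with its Euclidean norm. -/
abbrev Config (d : ℕ) : Type := EuclideanSpace ℝ (Fin d)

/-- The cotangent space `ℝ^d × (ℝ^d)*`, the universal cover of the cotangent bundle of the
torus `ℝ^d / ℤ^d`. -/
abbrev Phase (d : ℕ) : Type := Config d × StrongDual ℝ (Config d)

/-- The vector of `ℝ^d` with the given integer coordinates. -/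
noncomputable def intVec {d : ℕ} (r : Fin d → ℤ) : Config d :=
  WithLp.toLp 2 (fun i => (r i : ℝ))

/-- The lattice `ℤ^d` in `ℝ^d`. -/
def lattice (d : ℕ) : Set (Config d) := Set.range intVec

/-- `∂₁S(x,y)`, the differential of `S(·,y)` at `x`, for a differentiable `S`. -/
noncomputable def partialFst {d : ℕ} (S : Config d × Config d → ℝ) (x y : Config d) :
    StrongDual ℝ (Config d) :=
  (fderiv ℝ S (x, y)).comp (ContinuousLinearMap.inl ℝ (Config d) (Config d))

/-- `∂₂S(x,y)`, the differential of `S(x,·)` at `y`, for a differentiable `S`. -/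
noncomputable def partialSnd {d : ℕ} (S : Config d × Config d → ℝ) (x y : Config d) :
    StrongDual ℝ (Config d) :=
  (fderiv ℝ S (x, y)).comp (ContinuousLinearMap.inr ℝ (Config d) (Config d))

/-- Generating functions: `C^2`, invariant under the diagonal action of `ℤ^d`, and uniformly
twisting. For a `C^2` function the double sum of `∂²S/∂x_i∂y_j (x,y) ξ_i ξ_j` over `i` and `j`
is the second differential `D²S(x,y)` evaluated at the pair `(ξ,0)`, `(0,ξ)`. -/
structure GeneratingFunction (d : ℕ) where
  toFun : Config d × Config d → ℝ
  contDiff : ContDiff ℝ 2 toFun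
  periodic : ∀ (r : Fin d → ℤ) (x y : Config d),
    toFun (x + intVec r, y + intVec r) = toFun (x, y)
  twist : ∃ A : ℝ, 0 < A ∧ ∀ x y ξ : Config d,
    fderiv ℝ (fderiv ℝ toFun) (x, y) (ξ, 0) (0, ξ) ≤ -A * ‖ξ‖ ^ 2

/-! ### The twist map generated by `S` -/

/-- A differentiable map whose differentials are uniformly negative is a bijection. -/
theorem bijective_of_uniformly_negative {d : ℕ} (g : Config d → StrongDual ℝ (Config d))
    (g' : Config d → Config d →L[ℝ] StrongDual ℝ (Config d))
    (hg : ∀ y, HasFDerivAt g (g' y) y) {A : ℝ} (hA : 0 < A)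
    (hneg : ∀ y ξ, g' y ξ ξ ≤ -A * ‖ξ‖ ^ 2) : Function.Bijective g := by
  have mono : ∀ y z, (g y - g z) (y - z) ≤ -A * ‖y - z‖ ^ 2 := by
    intro y z
    have hd : ∀ t : ℝ, HasDerivAt (fun t : ℝ => g (z + t • (y - z)) (y - z))
        (g' (z + t • (y - z)) (y - z) (y - z)) t := by
      intro t
      have h1 : HasDerivAt (fun t : ℝ => z + t • (y - z)) (y - z) t := by
        simpa using ((hasDerivAt_id t).smul_const (y - z)).const_add z
      have h2 : HasDerivAt (fun t : ℝ => g (z + t • (y - z)))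
          (g' (z + t • (y - z)) (y - z)) t :=
        (hg (z + t • (y - z))).comp_hasDerivAt t h1
      have h3 := (ContinuousLinearMap.apply ℝ ℝ (y - z)).hasFDerivAt.comp_hasDerivAt t h2
      exact h3
    obtain ⟨t, -, ht⟩ := exists_hasDerivAt_eq_slope
      (fun t : ℝ => g (z + t • (y - z)) (y - z))
      (fun t => g' (z + t • (y - z)) (y - z) (y - z)) (zero_lt_one)
      (fun t _ => (hd t).continuousAt.continuousWithinAt) (fun t _ => hd t)
    have h3 := hneg (z + t • (y - z)) (y - z)
    have h4 : (g y - g z) (y - z) = g y (y - z) - g z (y - z) := rfl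
    simp only [one_smul, zero_smul, add_sub_cancel, add_zero, sub_zero, div_one] at ht
    linarith
  have cont : Continuous g := continuous_iff_continuousAt.2 fun y => (hg y).continuousAt
  have expand : ∀ y z, A * ‖y - z‖ ≤ ‖g y - g z‖ := by
    intro y z
    rcases eq_or_lt_of_le (norm_nonneg (y - z)) with h | h
    · rw [← h]; simp
    · have h1 := (g y - g z).le_opNorm (y - z)
      have h2 := mono y z
      have h3 := neg_abs_le ((g y - g z) (y - z))
      rw [Real.norm_eq_abs] at h1
      have : A * ‖y - z‖ * ‖y - z‖ ≤ ‖g y - g z‖ * ‖y - z‖ := by nlinarith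
      exact le_of_mul_le_mul_right this h
  refine ⟨fun y z h => ?_, fun p => ?_⟩
  · have h1 := expand y z
    rw [h, sub_self, norm_zero] at h1
    have h2 : ‖y - z‖ ≤ 0 := by
      by_contra hc
      push Not at hc
      nlinarith [mul_pos hA hc]
    exact sub_eq_zero.1 (norm_le_zero_iff.1 h2)
  · let J := (InnerProductSpace.toDual ℝ (Config d)).symm
    let T : StrongDual ℝ (Config d) →L[ℝ] Config d := LinearMap.toContinuousLinearMap
      { toFun := J, map_add' := fun a b => J.map_add a b, map_smul' := fun a b => by simp }
    have hT : ∀ a, ‖T a‖ = ‖a‖ := fun a => J.norm_map a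
    have hT0 : ∀ a, T a = 0 → a = 0 := fun a ha => by
      rw [← norm_eq_zero, ← hT, ha, norm_zero]
    let h : Config d → Config d := fun y => T (g y - p)
    have hh : ∀ y, HasFDerivAt h
        (T.comp (g' y)) y := fun y =>
      T.hasFDerivAt.comp y ((hg y).sub_const p)
    have coer : Filter.Tendsto (fun y => ‖h y‖ ^ 2) (Filter.cocompact (Config d))
        Filter.atTop := by
      have h1 : Filter.Tendsto (fun y : Config d => A * ‖y‖ - ‖g 0 - p‖)
          (Filter.cocompact (Config d)) Filter.atTop :=
        Filter.tendsto_atTop_add_const_right _ _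
          ((tendsto_norm_cocompact_atTop).const_mul_atTop hA)
      have h2 : Filter.Tendsto (fun y => ‖h y‖) (Filter.cocompact (Config d))
          Filter.atTop := by
        refine Filter.tendsto_atTop_mono (fun y => ?_) h1
        have e1 := expand y 0
        have e2 := norm_sub_le (g y - p) (g 0 - p)
        rw [sub_sub_sub_cancel_right] at e2
        have e3 : ‖h y‖ = ‖g y - p‖ := hT _
        rw [sub_zero] at e1
        rw [e3]
        linarith
      exact (Filter.tendsto_pow_atTop (two_ne_zero)).comp h2
    have hcont : Continuous fun y => ‖h y‖ ^ 2 :=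
      ((T.continuous.comp (cont.sub continuous_const)).norm).pow 2
    obtain ⟨y, hy⟩ := hcont.exists_forall_le coer
    have hmin : IsLocalMin (fun y => ‖h y‖ ^ 2) y := Filter.Eventually.of_forall hy
    have hz := hmin.hasFDerivAt_eq_zero (hh y).norm_sq
    have inj : Function.Injective (g' y) := by
      rw [injective_iff_map_eq_zero]
      intro ξ hξ
      have h1 := hneg y ξ
      rw [hξ] at h1
      simp only [zero_apply] at h1
      have h2 : ‖ξ‖ ^ 2 ≤ 0 := by nlinarith
      exact norm_eq_zero.1 (pow_eq_zero_iff (two_ne_zero) |>.1 (le_antisymm h2 (sq_nonneg _)))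
    have inj' : Function.Injective
        (T.comp (g' y) : Config d →ₗ[ℝ] Config d) := by
      intro a b hab
      have h1 : T (g' y a) = T (g' y b) := hab
      rw [← sub_eq_zero, ← map_sub] at h1
      exact inj (sub_eq_zero.1 (hT0 _ h1))
    obtain ⟨ξ, hξ⟩ := LinearMap.injective_iff_surjective.1 inj' (h y)
    have h5 := congrArg (fun L => L ξ) hz
    have hξ' : T (g' y ξ) = h y := hξ
    have h6 : h y = 0 := by
      simp at h5
      rw [hξ'] at h5
      simpa using h5
    refine ⟨y, sub_eq_zero.1 ?_⟩
    exact hT0 _ h6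

namespace GeneratingFunction

variable {d : ℕ} (S : GeneratingFunction d)

theorem hasFDerivAt_fderiv (q : Config d × Config d) :
    HasFDerivAt (fderiv ℝ S.toFun) (fderiv ℝ (fderiv ℝ S.toFun) q) q :=
  ((S.contDiff.fderiv_right (m := 1) (by norm_num)).differentiable (by norm_num) q).hasFDerivAt

/-- `y ↦ ∂₁S(x,y)` is a bijection from `ℝ^d` to its dual. -/
theorem bijective_partialFst (x : Config d) :
    Function.Bijective fun y => partialFst S.toFun x y := by
  obtain ⟨A, hA, h⟩ := S.twist
  refine bijective_of_uniformly_negative _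
    (fun y => ((ContinuousLinearMap.compL ℝ (Config d) (Config d × Config d) ℝ).flip
      (ContinuousLinearMap.inl ℝ (Config d) (Config d))).comp
        ((fderiv ℝ (fderiv ℝ S.toFun) (x, y)).comp
          (ContinuousLinearMap.inr ℝ (Config d) (Config d)))) (fun y => ?_) hA (fun y ξ => ?_)
  · exact ((ContinuousLinearMap.compL ℝ (Config d) (Config d × Config d) ℝ).flip
      (ContinuousLinearMap.inl ℝ (Config d) (Config d))).hasFDerivAt.comp y
      ((S.hasFDerivAt_fderiv (x, y)).comp y (hasFDerivAt_prodMk_right x y))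
  · have hs := S.contDiff.contDiffAt.isSymmSndFDerivAt (x := (x, y)) (by simp)
    have h1 := h x y ξ
    rw [hs] at h1
    simpa using h1

/-- `x ↦ ∂₂S(x,y)` is a bijection from `ℝ^d` to its dual. -/
theorem bijective_partialSnd (y : Config d) :
    Function.Bijective fun x => partialSnd S.toFun x y := by
  obtain ⟨A, hA, h⟩ := S.twist
  refine bijective_of_uniformly_negative _
    (fun x => ((ContinuousLinearMap.compL ℝ (Config d) (Config d × Config d) ℝ).flip
      (ContinuousLinearMap.inr ℝ (Config d) (Config d))).comp
        ((fderiv ℝ (fderiv ℝ S.toFun) (x, y)).comp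
          (ContinuousLinearMap.inl ℝ (Config d) (Config d)))) (fun x => ?_) hA (fun x ξ => ?_)
  · exact ((ContinuousLinearMap.compL ℝ (Config d) (Config d × Config d) ℝ).flip
      (ContinuousLinearMap.inr ℝ (Config d) (Config d))).hasFDerivAt.comp x
      ((S.hasFDerivAt_fderiv (x, y)).comp x (hasFDerivAt_prodMk_left x y))
  · simpa using h x y ξ

/-- The unique `x'` with `p = -∂₁S(x,x')`. -/
noncomputable def next (q : Phase d) : Config d :=
  ((S.bijective_partialFst q.1).2 (-q.2)).choose

/-- The unique `x` with `p' = ∂₂S(x,x')`. -/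
noncomputable def prev (q : Phase d) : Config d :=
  ((S.bijective_partialSnd q.1).2 q.2).choose

theorem partialFst_next (q : Phase d) : partialFst S.toFun q.1 (S.next q) = -q.2 :=
  ((S.bijective_partialFst q.1).2 (-q.2)).choose_spec

theorem partialSnd_prev (q : Phase d) : partialSnd S.toFun (S.prev q) q.1 = q.2 :=
  ((S.bijective_partialSnd q.1).2 q.2).choose_spec

/-- The twist map generated by `S`, lifted to the universal cover `ℝ^d × (ℝ^d)*` of the
cotangent bundle of the torus, as a permutation of that space. -/
noncomputable def twistMap : Equiv.Perm (Phase d) where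
  toFun q := (S.next q, partialSnd S.toFun q.1 (S.next q))
  invFun q := (S.prev q, -partialFst S.toFun (S.prev q) q.1)
  left_inv q := by
    have h : S.prev (S.next q, partialSnd S.toFun q.1 (S.next q)) = q.1 :=
      (S.bijective_partialSnd (S.next q)).1 (S.partialSnd_prev _)
    ext1
    · exact h
    · simp only [h, S.partialFst_next, neg_neg]
  right_inv q := by
    have h : S.next (S.prev q, -partialFst S.toFun (S.prev q) q.1) = q.1 :=
      (S.bijective_partialFst (S.prev q)).1
        ((S.partialFst_next (S.prev q, -partialFst S.toFun (S.prev q) q.1)).trans (neg_neg _))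
    ext1
    · exact h
    · simp only [h, S.partialSnd_prev]

/-- The relation that implicitly defines the twist map. -/
theorem twistMap_eq_iff (x x' : Config d) (p p' : StrongDual ℝ (Config d)) :
    S.twistMap (x, p) = (x', p') ↔
      p = -partialFst S.toFun x x' ∧ p' = partialSnd S.toFun x x' := by
  have hn := S.partialFst_next (x, p)
  constructor
  · intro h
    have h1 : S.next (x, p) = x' := congrArg Prod.fst h
    have h2 : partialSnd S.toFun x (S.next (x, p)) = p' := congrArg Prod.snd h
    rw [h1] at h2 hn
    exact ⟨by rw [hn, neg_neg], h2.symm⟩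
  · rintro ⟨rfl, rfl⟩
    have h1 : S.next (x, -partialFst S.toFun x x') = x' :=
      (S.bijective_partialFst x).1 (hn.trans (neg_neg _))
    change (S.next _, partialSnd S.toFun x (S.next _)) = _
    rw [h1]

end GeneratingFunction

/-- The vertical space `{0} × (ℝ^d)*`: the kernel of the differential of `(x,p) ↦ x` (at every
point). -/
noncomputable def vertical (d : ℕ) : Submodule ℝ (Phase d) :=
  LinearMap.ker (LinearMap.fst ℝ (Config d) (StrongDual ℝ (Config d)))

/-- The twist map of `S` is without conjugate points: for every `n ≠ 0` in `ℤ` and every point,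
`DF^n` maps the vertical space to a space that meets the vertical space in `0` only. The
condition is written on the universal cover; the covering map onto the cotangent bundle of the
torus is a local diffeomorphism that intertwines the lifted map with the map itself and respects
the vertical spaces. -/
def GeneratingFunction.WithoutConjugatePoints {d : ℕ} (S : GeneratingFunction d) : Prop :=
  ∀ (q : Phase d) (n : ℤ), n ≠ 0 →
    vertical d ⊓
      (vertical d).map (fderiv ℝ (⇑(S.twistMap ^ n)) q : Phase d →ₗ[ℝ] Phase d) = ⊥

/-- `S_c(x,y) = S(x,y) + c(x - y)`, for a cohomology class `c` of the torus, that is an element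
of `(ℝ^d)*`. -/
def GeneratingFunction.shift {d : ℕ} (S : GeneratingFunction d) (c : StrongDual ℝ (Config d)) :
    Config d × Config d → ℝ :=
  fun q => S.toFun q + c (q.1 - q.2)

/-! ### Action, Mañé potential and Aubry set of a function `L` on `ℝ^d × ℝ^d` -/

section Action

variable {d : ℕ} (L : Config d × Config d → ℝ)

/-- The action `L(x_0, …, x_n)`; it only involves the first `n + 1` terms of the sequence. -/
noncomputable def action (n : ℕ) (x : ℕ → Config d) : ℝ :=
  ∑ k ∈ Finset.range n, L (x k, x (k + 1))

/-- The infimum of `liminf L(x_0, …, x_n) / n` over all sequences, in the extended reals. -/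
noncomputable def holonomicInf : EReal :=
  ⨅ x : ℕ → Config d,
    Filter.liminf (fun n : ℕ => ((action L n x / n : ℝ) : EReal)) Filter.atTop

/-- The minimizing holonomic value: the preceding infimum as a real number. -/
noncomputable def minimizingHolonomicValue : ℝ := (holonomicInf L).toReal

/-- The action of `(x_0, …, x_n)` for `L` minus its minimizing holonomic value. -/
noncomputable def normalizedAction (n : ℕ) (x : ℕ → Config d) : ℝ :=
  action L n x - n * minimizingHolonomicValue L

/-- The normalized actions of the sequences `(x_0, …, x_n)` with `n ≥ 1` that go from `x` to
`y` modulo `ℤ^d`. -/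
def connectingActions (x y : Config d) : Set ℝ :=
  {a | ∃ (n : ℕ) (w : ℕ → Config d), 1 ≤ n ∧ w 0 = x ∧ w n - y ∈ lattice d ∧
    a = normalizedAction L n w}

/-- The Mañé potential. -/
noncomputable def manePotential (x y : Config d) : ℝ := sInf (connectingActions L x y)

/-- The Aubry set. -/
def aubrySet : Set (Config d × Config d) :=
  {q | ∀ ε : ℝ, 0 < ε → ∃ (n : ℕ) (w : ℕ → Config d), 1 ≤ n ∧ w n - w 0 ∈ lattice d ∧
    ‖q.1 - w 0‖ < ε ∧ ‖q.2 - w 1‖ < ε ∧ normalizedAction L n w < ε}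

end Action

end TwistMap

/-! The first half is a discrete variational argument. With fixed end points the action of finite
sequences is coercive, since the twist condition makes S grow quadratically off the diagonal; its
critical points are the orbit segments. A vector in the kernel of the Hessian at an orbit segment is
a Jacobi field vanishing at both ends, hence zero without conjugate points. So the Hessian is
nondegenerate along every orbit segment, positive semidefinite along one minimizer, and, as phase
space is connected, positive definite along all of them (`interiorHessian_pos`). A coercive function
whose critical points are all nondegenerate minima has only one (`TwistMap.eq_of_critical`, by
gradient descent and connectedness), so every orbit segment minimizes (`action_orbit_le`).

Let F(x) be the minimal action of n steps from x to x + r. It is periodic and attains a maximum at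
some z. There the minimizer closes up to an orbit periodic modulo translation by r, and all its
iterates minimize. If F(x) < F(z), going from z to x, turning often around the cheaper loop at x and
coming back would beat the iterated orbit. Hence F is constant (`exists_isLeast_loop`), and adding c
only changes the constant.

The second half works for any periodic cost with this constancy. A pigeonhole argument gives loops
of arbitrarily small normalized action somewhere (`exists_loop_lt`), and constancy moves them to
every point: this yields the projection of the Aubry set and φ(x,x) = 0. Such a loop is minimal even
among loops with a moved base point, so x is critical for the sum of the two adjacent costs.
Replacing x by y in one end of the loop at a time gives φ(x,y) + φ(y,x) = o(‖y - x‖)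
(`symmetrized_manePotential_le`). By the triangle inequality the symmetrized potential then has zero
derivative everywhere, so it vanishes; additivity follows. -/

namespace TwistMap

/-! ### Uniqueness of critical points that are all nondegenerate minima. -/

section CriticalPoints

open Filter Topology Bornology

/-- A positive definite form on a finite-dimensional space is uniformly positive. -/
theorem exists_pos_mul_sq_le {E : Type*} [NormedAddCommGroup E] [NormedSpace ℝ E]
    [FiniteDimensional ℝ E] (B : E →L[ℝ] StrongDual ℝ E) (hB : ∀ ξ, ξ ≠ 0 → 0 < B ξ ξ) :
    ∃ a : ℝ, 0 < a ∧ ∀ ξ, a * ‖ξ‖ ^ 2 ≤ B ξ ξ := by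
  have hc : Continuous fun ξ => B ξ ξ := B.continuous.clm_apply continuous_id
  -- This form of the extreme value theorem also covers the empty sphere of the zero space.
  obtain ⟨a, ha, h⟩ := (isCompact_sphere (0 : E) 1).exists_forall_le' hc.continuousOn
    (a := 0) (fun ξ hξ => hB ξ (by rintro rfl; simp at hξ))
  refine ⟨a, ha, fun ξ => ?_⟩
  rcases eq_or_ne ξ 0 with rfl | h0
  · simp
  have hn : 0 < ‖ξ‖ := norm_pos_iff.2 h0
  have h1 := h (‖ξ‖⁻¹ • ξ) (by simp [norm_smul, hn.ne'])
  simp only [map_smul, smul_apply, smul_eq_mul] at h1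
  have h2 : ‖ξ‖⁻¹ * (‖ξ‖⁻¹ * B ξ ξ) = B ξ ξ / ‖ξ‖ ^ 2 := by field_simp
  rw [h2, le_div_iff₀ (by positivity)] at h1
  exact h1

theorem hasDerivAt_comp_line {E F : Type*} [NormedAddCommGroup E] [NormedSpace ℝ E]
    [NormedAddCommGroup F] [NormedSpace ℝ F] {f : E → F} {f' : E → E →L[ℝ] F}
    (h : ∀ u, HasFDerivAt f (f' u) u) (x v : E) (t : ℝ) :
    HasDerivAt (fun t : ℝ => f (x + t • v)) (f' (x + t • v) v) t := by
  have h1 : HasDerivAt (fun t : ℝ => x + t • v) v t := by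
    simpa using ((hasDerivAt_id t).smul_const v).const_add x
  exact (h (x + t • v)).comp_hasDerivAt t h1

/-- The mean value theorem on a segment. -/
theorem exists_segment_eq {E : Type*} [NormedAddCommGroup E] [NormedSpace ℝ E] {W : E → ℝ}
    {W' : E → StrongDual ℝ E} (h1 : ∀ u, HasFDerivAt W (W' u) u) (x y : E) :
    ∃ t ∈ Set.Ioo (0 : ℝ) 1, W y - W x = W' (x + t • (y - x)) (y - x) := by
  have hd := hasDerivAt_comp_line h1 x (y - x)
  obtain ⟨t, ht, h⟩ := exists_hasDerivAt_eq_slope _ _ (zero_lt_one)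
      (fun t _ => (hd t).continuousAt.continuousWithinAt) (fun t _ => hd t)
  refine ⟨t, ht, ?_⟩
  simp only [one_smul, zero_smul, add_sub_cancel, add_zero, sub_zero, div_one] at h
  exact h.symm

/-- At a minimum the second derivative is positive semidefinite. -/
theorem second_deriv_nonneg_of_min {E : Type*} [NormedAddCommGroup E] [NormedSpace ℝ E]
    {W : E → ℝ} {W' : E → StrongDual ℝ E} {W'' : E → E →L[ℝ] StrongDual ℝ E}
    (h1 : ∀ u, HasFDerivAt W (W' u) u) (h2 : ∀ u, HasFDerivAt W' (W'' u) u)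
    {z : E} (hz : ∀ u, W z ≤ W u) (ξ : E) : 0 ≤ W'' z ξ ξ := by
  have hd := hasDerivAt_comp_line h1 z ξ
  have hd1 : ∀ t : ℝ, HasDerivAt (fun t : ℝ => W' (z + t • ξ) ξ) (W'' (z + t • ξ) ξ ξ) t := by
    intro t
    exact (ContinuousLinearMap.apply ℝ ℝ ξ).hasFDerivAt.comp_hasDerivAt t
      (hasDerivAt_comp_line h2 z ξ t)
  have e1 : deriv (fun t : ℝ => W (z + t • ξ)) = fun t : ℝ => W' (z + t • ξ) ξ :=
    funext fun t => (hd t).deriv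
  have e2 : deriv (deriv (fun t : ℝ => W (z + t • ξ))) 0 = W'' z ξ ξ := by
    rw [e1, (hd1 0).deriv]; simp
  have hmin : IsLocalMin (fun t : ℝ => W (z + t • ξ)) 0 :=
    Filter.Eventually.of_forall fun t => by simpa using hz _
  by_contra! hc
  -- A negative second derivative makes 0 a local maximum as well, so the function is locally
  -- constant and its second derivative is 0 after all.
  have hmax := isLocalMax_of_deriv_deriv_neg (e2.trans_lt hc) hmin.deriv_eq_zero
    (hd 0).continuousAt
  have hconst : (fun t : ℝ => W (z + t • ξ)) =ᶠ[𝓝 0] fun _ => W (z + (0 : ℝ) • ξ) := by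
    filter_upwards [hmin, hmax] with t h h' using le_antisymm h' h
  have := hconst.deriv.deriv_eq
  rw [e2] at this
  simp at this
  linarith

/-- A symmetric, positive semidefinite, nondegenerate form is positive definite. -/
theorem pos_of_nonneg_of_nondegenerate {E : Type*} [NormedAddCommGroup E] [NormedSpace ℝ E]
    (B : E →L[ℝ] StrongDual ℝ E) (hs : ∀ ξ ζ, B ξ ζ = B ζ ξ) (h0 : ∀ ξ, 0 ≤ B ξ ξ)
    (hn : ∀ ξ, (∀ ζ, B ξ ζ = 0) → ξ = 0) {ξ : E} (hξ : ξ ≠ 0) : 0 < B ξ ξ := by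
  refine lt_of_le_of_ne (h0 ξ) fun h => hξ (hn ξ fun ζ => ?_)
  by_contra hc
  have key : ∀ t : ℝ, 0 ≤ 2 * t * B ξ ζ + t ^ 2 * B ζ ζ := by
    intro t
    have := h0 (ξ + t • ζ)
    simp only [map_add, map_smul, add_apply, smul_apply, smul_eq_mul, ← h, hs ζ ξ] at this
    nlinarith
  have h3 := h0 ζ
  -- Nearly the minimizing t of the quadratic; the `+ 1` keeps the denominator positive when `B ζ ζ
  -- = 0`.
  have h4 := key (-(B ξ ζ) / (B ζ ζ + 1))
  have h5 : 2 * (-(B ξ ζ) / (B ζ ζ + 1)) * B ξ ζ + (-(B ξ ζ) / (B ζ ζ + 1)) ^ 2 * B ζ ζ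
      = - ((B ξ ζ) ^ 2 * (B ζ ζ + 2) / (B ζ ζ + 1) ^ 2) := by field_simp; ring
  rw [h5] at h4
  have : 0 < (B ξ ζ) ^ 2 * (B ζ ζ + 2) / (B ζ ζ + 1) ^ 2 := by positivity
  linarith

/-- Near a nondegenerate local minimum the differential is positive in the radial direction. -/
theorem exists_radial_pos {E : Type*} [NormedAddCommGroup E] [NormedSpace ℝ E]
    [FiniteDimensional ℝ E] {W' : E → StrongDual ℝ E} {W'' : E → E →L[ℝ] StrongDual ℝ E}
    (h2 : ∀ u, HasFDerivAt W' (W'' u) u) {z : E} (hz : W' z = 0)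
    (hpos : ∀ ξ, ξ ≠ 0 → 0 < W'' z ξ ξ) :
    ∃ ρ : ℝ, 0 < ρ ∧ ∀ x, x ≠ z → ‖x - z‖ ≤ ρ → 0 < W' x (x - z) := by
  obtain ⟨a, ha, hB⟩ := exists_pos_mul_sq_le _ hpos
  -- With this precision the linearization error consumes at most half of the quadratic term.
  have ho := (h2 z).isLittleO.def (half_pos ha)
  obtain ⟨ε, hε, hball⟩ := Metric.eventually_nhds_iff.1 ho
  refine ⟨ε / 2, half_pos hε, fun x hx hxz => ?_⟩
  have h3 := hball (y := x) (by rw [dist_eq_norm]; linarith)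
  rw [hz, sub_zero] at h3
  have h4 := (W' x - W'' z (x - z)).le_opNorm (x - z)
  rw [Real.norm_eq_abs] at h4
  have h5 := neg_abs_le ((W' x - W'' z (x - z)) (x - z))
  have h6 : (W' x - W'' z (x - z)) (x - z) = W' x (x - z) - W'' z (x - z) (x - z) := rfl
  have h7 := hB (x - z)
  have hn : 0 < ‖x - z‖ := norm_pos_iff.2 (sub_ne_zero.2 hx)
  have h8 : ‖W' x - W'' z (x - z)‖ * ‖x - z‖ ≤ a / 2 * ‖x - z‖ * ‖x - z‖ := by gcongr
  have h9 : 0 < a * ‖x - z‖ ^ 2 := by positivity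
  nlinarith

/-- At the intermediate point of the mean value theorem the direction `x - z` is a positive multiple
of the radial one. -/
theorem lt_of_radial_pos {E : Type*} [NormedAddCommGroup E] [NormedSpace ℝ E] {W : E → ℝ}
    {W' : E → StrongDual ℝ E} (h1 : ∀ u, HasFDerivAt W (W' u) u) {z : E} {ρ : ℝ}
    (hρ : ∀ x, x ≠ z → ‖x - z‖ ≤ ρ → 0 < W' x (x - z)) {x : E} (hx : x ≠ z)
    (hxz : ‖x - z‖ ≤ ρ) : W z < W x := by
  obtain ⟨t, ht, h⟩ := exists_segment_eq h1 z x
  have h3 := hρ (z + t • (x - z))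
    (by simp [ht.1.ne', sub_eq_zero, hx])
    (by
      rw [add_sub_cancel_left, norm_smul, Real.norm_eq_abs, abs_of_pos ht.1]
      nlinarith [norm_nonneg (x - z), ht.2])
  rw [add_sub_cancel_left, map_smul, smul_eq_mul] at h3
  have := pos_of_mul_pos_right h3 ht.1.le
  linarith

/-- Iterates of a map that decreases `W` by a multiple of `‖W'‖ ^ 2` accumulate at a critical
point. -/
theorem exists_accumulation_critical {E : Type*} [NormedAddCommGroup E] [NormedSpace ℝ E]
    {W : E → ℝ} {W' : E → StrongDual ℝ E} (hW : Continuous W) (hW' : Continuous W')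
    {K : Set E} (hK : IsCompact K) {T : E → E} (hT : ∀ x ∈ K, T x ∈ K) {κ : ℝ} (hκ : 0 < κ)
    (hdesc : ∀ x ∈ K, W (T x) + κ * ‖W' x‖ ^ 2 ≤ W x) {x : E} (hx : x ∈ K) :
    ∃ z ∈ K, W' z = 0 ∧ ∃ φ : ℕ → ℕ, StrictMono φ ∧
      Tendsto (fun k => T^[φ k] x) atTop (𝓝 z) := by
  have hmem : ∀ k, T^[k] x ∈ K := by
    intro k
    induction k with
    | zero => exact hx
    | succ k ih => rw [Function.iterate_succ_apply']; exact hT _ ih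
  obtain ⟨z, hzK, φ, hφ, hlim⟩ := hK.tendsto_subseq hmem
  refine ⟨z, hzK, ?_, φ, hφ, hlim⟩
  have hanti : Antitone fun k => W (T^[k] x) := antitone_nat_of_succ_le fun k => by
    have := hdesc _ (hmem k)
    rw [Function.iterate_succ_apply']
    nlinarith [sq_nonneg ‖W' (T^[k] x)‖]
  have hbdd : BddBelow (Set.range fun k => W (T^[k] x)) := by
    obtain ⟨b, hb⟩ := hK.bddBelow_image hW.continuousOn
    refine ⟨b, ?_⟩
    rintro _ ⟨k, rfl⟩
    exact hb ⟨_, hmem k, rfl⟩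
  have hconv := tendsto_atTop_ciInf hanti hbdd
  have h0 : Tendsto (fun k => W (T^[k] x) - W (T^[k + 1] x)) atTop (𝓝 0) := by
    simpa using hconv.sub (hconv.comp (tendsto_add_atTop_nat 1))
  -- The squared differential is dominated by the decrements of a convergent sequence.
  have h1 : Tendsto (fun k => κ * ‖W' (T^[φ k] x)‖ ^ 2) atTop (𝓝 0) := by
    refine squeeze_zero (fun k => by positivity) (fun k => ?_) (h0.comp hφ.tendsto_atTop)
    have := hdesc _ (hmem (φ k))
    simp only [Function.comp_apply]
    rw [Function.iterate_succ_apply']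
    linarith
  have h2 : Tendsto (fun k => κ * ‖W' (T^[φ k] x)‖ ^ 2) atTop (𝓝 (κ * ‖W' z‖ ^ 2)) :=
    ((((hW'.norm).pow 2).const_smul κ).tendsto z).comp hlim
  have h3 := tendsto_nhds_unique h2 h1
  have h4 : ‖W' z‖ ^ 2 = 0 := by
    rcases mul_eq_zero.1 h3 with h | h
    · exact absurd h hκ.ne'
    · exact h
  simpa using h4

/-- If every critical point has a trapping neighbourhood that contains no other critical point,
then two critical points in a connected part of `K` agree. -/
theorem eq_of_trapping {E : Type*} [NormedAddCommGroup E] [NormedSpace ℝ E]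
    {W : E → ℝ} {W' : E → StrongDual ℝ E} (hW : Continuous W) (hW' : Continuous W')
    {K : Set E} (hK : IsCompact K) {T : E → E} (hTc : Continuous T) (hT : ∀ x ∈ K, T x ∈ K)
    {κ : ℝ} (hκ : 0 < κ) (hdesc : ∀ x ∈ K, W (T x) + κ * ‖W' x‖ ^ 2 ≤ W x)
    (htrap : ∀ z ∈ K, W' z = 0 → ∃ N : Set E, IsOpen N ∧ z ∈ N ∧ (∀ x ∈ K, x ∈ N → T x ∈ N) ∧
      ∀ y ∈ closure N, W' y = 0 → y = z)
    {C : Set E} (hC : IsPreconnected C) (hCK : C ⊆ K) {P Q : E} (hP : P ∈ C) (hQ : Q ∈ C)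
    (hP' : W' P = 0) (hQ' : W' Q = 0) : P = Q := by
  by_contra hPQ
  choose! N hNo hzN hNT hNc using htrap
  have hmem : ∀ x ∈ K, ∀ k, T^[k] x ∈ K := by
    intro x hx k
    induction k with
    | zero => exact hx
    | succ k ih => rw [Function.iterate_succ_apply']; exact hT _ ih
  have hstay : ∀ x ∈ K, ∀ z ∈ K, W' z = 0 → ∀ k, T^[k] x ∈ N z → ∀ j, k ≤ j →
      T^[j] x ∈ N z := by
    intro x hx z hz hz' k hk j hj
    induction j, hj using Nat.le_induction with
    | base => exact hk
    | succ j _ ih => rw [Function.iterate_succ_apply']; exact hNT z hz hz' _ (hmem x hx j) ih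
  -- The basin of `z`: points whose iterates ever enter the trapping neighbourhood. Basins are open
  -- and cover `K`. A point of two basins would have a critical accumulation point equal to both
  -- centres, so connectedness of `C` forbids two critical points in it.
  let U : E → Set E := fun z => ⋃ k, T^[k] ⁻¹' N z
  have hU : ∀ z ∈ K, W' z = 0 → IsOpen (U z) := fun z hz hz' =>
    isOpen_iUnion fun k => (hNo z hz hz').preimage (hTc.iterate k)
  have hlimit : ∀ x ∈ K, ∀ z ∈ K, W' z = 0 → x ∈ U z → ∀ (y : E) (φ : ℕ → ℕ),
      StrictMono φ → Tendsto (fun k => T^[φ k] x) atTop (𝓝 y) → W' y = 0 → y = z := by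
    intro x hx z hz hz' hxU y φ hφ hlim hy
    obtain ⟨k, hk⟩ := Set.mem_iUnion.1 hxU
    refine hNc z hz hz' y (mem_closure_of_tendsto hlim ?_) hy
    filter_upwards [hφ.tendsto_atTop.eventually_ge_atTop k] with j hj
    exact hstay x hx z hz hz' k hk _ hj
  have hPK := hCK hP
  have hQK := hCK hQ
  let U2 : Set E := ⋃ z ∈ {z | z ∈ K ∧ W' z = 0 ∧ z ≠ P}, U z
  have hU2 : IsOpen U2 := isOpen_biUnion fun z hz => hU z hz.1 hz.2.1
  have hself : ∀ z ∈ K, W' z = 0 → z ∈ U z := fun z hz hz' =>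
    Set.mem_iUnion.2 ⟨0, hzN z hz hz'⟩
  have hcover : C ⊆ U P ∪ U2 := by
    intro x hx
    obtain ⟨z, hz, hz', φ, hφ, hlim⟩ :=
      exists_accumulation_critical hW hW' hK hT hκ hdesc (hCK hx)
    obtain ⟨k, hk⟩ := (hlim.eventually ((hNo z hz hz').mem_nhds (hzN z hz hz'))).exists
    have hxU : x ∈ U z := Set.mem_iUnion.2 ⟨φ k, hk⟩
    rcases eq_or_ne z P with rfl | hzP
    · exact Or.inl hxU
    · exact Or.inr (Set.mem_biUnion ⟨hz, hz', hzP⟩ hxU)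
  obtain ⟨x, hxC, hx1, hx2⟩ := hC _ _ (hU P hPK hP') hU2 hcover ⟨P, hP, hself P hPK hP'⟩
    ⟨Q, hQ, Set.mem_biUnion ⟨hQK, hQ', Ne.symm hPQ⟩ (hself Q hQK hQ')⟩
  obtain ⟨z, ⟨hz, hz', hzP⟩, hxz⟩ := Set.mem_iUnion₂.1 hx2
  obtain ⟨y, hy, hy', φ, hφ, hlim⟩ :=
    exists_accumulation_critical hW hW' hK hT hκ hdesc (hCK hxC)
  exact hzP ((hlimit x (hCK hxC) z hz hz' hxz y φ hφ hlim hy').symm.trans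
    (hlimit x (hCK hxC) P hPK hP' hx1 y φ hφ hlim hy'))

/-- A function with bounded sublevel sets all of whose critical points are nondegenerate local
minima has at most one critical point. -/
theorem eq_of_critical {E : Type*} [NormedAddCommGroup E] [InnerProductSpace ℝ E]
    [FiniteDimensional ℝ E] {W : E → ℝ} {W' : E → StrongDual ℝ E}
    {W'' : E → E →L[ℝ] StrongDual ℝ E}
    (h1 : ∀ u, HasFDerivAt W (W' u) u) (h2 : ∀ u, HasFDerivAt W' (W'' u) u)
    (h3 : Continuous W'') (hb : ∀ C, IsBounded {u | W u ≤ C})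
    (hpos : ∀ u, W' u = 0 → ∀ ξ, ξ ≠ 0 → 0 < W'' u ξ ξ) {P Q : E}
    (hP : W' P = 0) (hQ : W' Q = 0) : P = Q := by
  have hW : Continuous W := continuous_iff_continuousAt.2 fun u => (h1 u).continuousAt
  have hW' : Continuous W' := continuous_iff_continuousAt.2 fun u => (h2 u).continuousAt
  have hseg : IsCompact (segment ℝ P Q) := by
    rw [segment_eq_image']
    exact isCompact_Icc.image (by fun_prop)
  obtain ⟨c, hc⟩ := hseg.bddAbove_image hW.continuousOn
  let K : Set E := {u | W u ≤ c}
  have hK : IsCompact K := Metric.isCompact_of_isClosed_isBounded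
    (isClosed_le hW continuous_const) (hb c)
  have hsub : segment ℝ P Q ⊆ K := fun u hu => hc ⟨u, hu, rfl⟩
  obtain ⟨R, hR⟩ := (hb c).subset_closedBall (0 : E)
  have hBc : IsCompact (Metric.closedBall (0 : E) (R + 1)) := isCompact_closedBall _ _
  obtain ⟨M₀, hM₀⟩ := hBc.exists_bound_of_continuousOn (f := W'') h3.continuousOn
  obtain ⟨G₀, hG₀⟩ := hK.exists_bound_of_continuousOn (f := W') hW'.continuousOn
  obtain ⟨M, hM, hM1⟩ : ∃ M, (∀ u ∈ Metric.closedBall (0 : E) (R + 1), ‖W'' u‖ ≤ M) ∧ 0 < M :=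
    ⟨max M₀ 1, fun u hu => (hM₀ u hu).trans (le_max_left _ _),
      zero_lt_one.trans_le (le_max_right _ _)⟩
  obtain ⟨G, hG, hG1⟩ : ∃ G, (∀ u ∈ K, ‖W' u‖ ≤ G) ∧ 0 < G :=
    ⟨max G₀ 1, fun u hu => (hG₀ u hu).trans (le_max_left _ _),
      zero_lt_one.trans_le (le_max_right _ _)⟩
  -- The step size of gradient descent. `h * G ≤ 1` keeps one step from `K` inside the ball of
  -- radius `R + 1`, where `M` bounds the Hessian; `h * M ≤ 1 / 2` makes the second-order error at
  -- most half of the first-order gain `h * ‖W'‖ ^ 2`.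
  obtain ⟨h, hh, hhG, hhM⟩ : ∃ h : ℝ, 0 < h ∧ h * G ≤ 1 ∧ h * M ≤ 1 / 2 := by
    refine ⟨min (1 / G) (1 / (2 * M)), by positivity, ?_, ?_⟩
    · calc _ ≤ 1 / G * G := by gcongr; exact min_le_left _ _
        _ = 1 := by field_simp
    · calc _ ≤ 1 / (2 * M) * M := by gcongr; exact min_le_right _ _
        _ = 1 / 2 := by field_simp
  have hlip : ∀ x ∈ Metric.closedBall (0 : E) (R + 1), ∀ y ∈ Metric.closedBall (0 : E) (R + 1),
      ‖W' y - W' x‖ ≤ M * ‖y - x‖ := fun x hx y hy =>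
    (convex_closedBall (0 : E) (R + 1)).norm_image_sub_le_of_norm_hasFDerivWithin_le
      (fun u _ => (h2 u).hasFDerivWithinAt) hM hx hy
  let g : E → E := fun x => (InnerProductSpace.toDual ℝ E).symm (W' x)
  have hg : ∀ x v, W' x v = inner ℝ (g x) v := fun x v =>
    (InnerProductSpace.toDual_symm_apply).symm
  have hgn : ∀ x, ‖g x‖ = ‖W' x‖ := fun x => LinearIsometryEquiv.norm_map _ _
  have hgc : Continuous g := (LinearIsometryEquiv.continuous _).comp hW'
  let T : E → E := fun x => x - h • g x
  have hTx : ∀ x, T x - x = -(h • g x) := fun x => by simp [T]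
  have hTn : ∀ x, ‖T x - x‖ = h * ‖W' x‖ := fun x => by
    rw [hTx, norm_neg, norm_smul, hgn, Real.norm_eq_abs, abs_of_pos hh]
  have hKB : ∀ x ∈ K, x ∈ Metric.closedBall (0 : E) (R + 1) := fun x hx =>
    Metric.closedBall_subset_closedBall (by linarith) (hR hx)
  have hTB : ∀ x ∈ K, T x ∈ Metric.closedBall (0 : E) (R + 1) := by
    intro x hx
    have e1 : ‖x‖ ≤ R := by simpa using hR hx
    have e2 : h * ‖W' x‖ ≤ h * G := by gcongr; exact hG x hx
    have e3 := norm_add_le x (T x - x)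
    rw [add_sub_cancel, hTn] at e3
    rw [mem_closedBall_zero_iff]
    linarith
  have hdesc : ∀ x ∈ K, W (T x) + h / 2 * ‖W' x‖ ^ 2 ≤ W x := by
    intro x hx
    obtain ⟨t, ht, hmv⟩ := exists_segment_eq h1 x (T x)
    have hξ : x + t • (T x - x) ∈ Metric.closedBall (0 : E) (R + 1) :=
      (convex_closedBall (0 : E) (R + 1)).add_smul_sub_mem (hKB x hx) (hTB x hx)
        ⟨ht.1.le, ht.2.le⟩
    have e1 := hlip x (hKB x hx) _ hξ
    rw [add_sub_cancel_left, norm_smul, Real.norm_eq_abs, abs_of_pos ht.1] at e1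
    have e2 := (W' (x + t • (T x - x)) - W' x).le_opNorm (T x - x)
    have e3 := le_abs_self ((W' (x + t • (T x - x)) - W' x) (T x - x))
    rw [Real.norm_eq_abs] at e2
    have e4 : (W' (x + t • (T x - x)) - W' x) (T x - x)
      = W' (x + t • (T x - x)) (T x - x) - W' x (T x - x) := rfl
    have e5 : W' x (T x - x) = - (h * ‖W' x‖ ^ 2) := by
      rw [hTx, map_neg, map_smul, hg, real_inner_self_eq_norm_sq, hgn, smul_eq_mul]
    have e6 : ‖W' (x + t • (T x - x)) - W' x‖ * ‖T x - x‖ ≤ M * ‖T x - x‖ * ‖T x - x‖ := by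
      gcongr
      refine e1.trans ?_
      gcongr
      nlinarith [norm_nonneg (T x - x), ht.2]
    rw [hTn] at e6
    have e7 : M * (h * ‖W' x‖) * (h * ‖W' x‖) = (h * M) * (h * ‖W' x‖ ^ 2) := by ring
    have e8 : (h * M) * (h * ‖W' x‖ ^ 2) ≤ 1 / 2 * (h * ‖W' x‖ ^ 2) := by gcongr
    rw [hTn] at e2
    linarith
  have hTK : ∀ x ∈ K, T x ∈ K := fun x hx => by
    have e1 := hdesc x hx
    have e2 : W x ≤ c := hx
    have e3 : 0 ≤ h / 2 * ‖W' x‖ ^ 2 := by positivity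
    change W (T x) ≤ c
    linarith
  refine eq_of_trapping hW hW' hK (continuous_id.sub (hgc.const_smul h)) hTK (half_pos hh) hdesc
    ?_ (convex_segment P Q).isPreconnected hsub (left_mem_segment ℝ P Q)
    (right_mem_segment ℝ P Q) hP hQ
  intro z hz hz'
  obtain ⟨ρ, hρ, hrad⟩ := exists_radial_pos h2 hz' (hpos z hz')
  -- A potential barrier: `W ≥ m > W z` on this annulus. From the half ball one step reaches
  -- distance at most `3ρ / 4`, so it cannot jump over the annulus, nor land in it while `W < m`.
  have hAc : IsCompact (Metric.closedBall z ρ \ Metric.ball z (ρ / 2)) :=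
    (isCompact_closedBall z ρ).diff Metric.isOpen_ball
  obtain ⟨m, hm, hmA⟩ := hAc.exists_forall_le' hW.continuousOn (a := W z) (by
    intro x hx
    refine lt_of_radial_pos h1 hrad ?_ ?_
    · rintro rfl
      exact hx.2 (Metric.mem_ball_self (half_pos hρ))
    · simpa [dist_eq_norm] using hx.1)
  refine ⟨Metric.ball z (ρ / 2) ∩ {x | W x < m}, Metric.isOpen_ball.inter
    (isOpen_lt hW continuous_const), ⟨Metric.mem_ball_self (half_pos hρ), hm⟩, ?_, ?_⟩
  · rintro x hx ⟨hx1, hx2⟩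
    have e1 : ‖x - z‖ < ρ / 2 := by simpa [dist_eq_norm] using hx1
    have e2 := hlip z (hKB z hz) x (hKB x hx)
    rw [hz', sub_zero] at e2
    have e3 : h * ‖W' x‖ ≤ h * (M * ‖x - z‖) := by gcongr
    have e4 : h * (M * ‖x - z‖) ≤ 1 / 2 * ‖x - z‖ := by rw [← mul_assoc]; gcongr
    have e5 := norm_add_le (T x - x) (x - z)
    rw [sub_add_sub_cancel, hTn] at e5
    have e6 : W (T x) < m := by
      have := hdesc x hx
      have e7 : 0 ≤ h / 2 * ‖W' x‖ ^ 2 := by positivity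
      have e8 : W x < m := hx2
      linarith
    refine ⟨?_, e6⟩
    by_contra hc
    have := hmA (T x) ⟨by rw [Metric.mem_closedBall, dist_eq_norm]; linarith, hc⟩
    linarith
  · intro y hy hy'
    by_contra hyz
    have e1 : y ∈ Metric.closedBall z (ρ / 2) :=
      (closure_mono Set.inter_subset_left).trans Metric.closure_ball_subset_closedBall hy
    have e2 : ‖y - z‖ ≤ ρ := by
      rw [Metric.mem_closedBall, dist_eq_norm] at e1
      linarith
    have := hrad y hyz e2
    rw [hy'] at this
    simp at this

end CriticalPoints
end TwistMap

/-! ### Lattice periodicity and quadratic growth of generating functions. -/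

namespace TwistMap

section Lattice

variable {d : ℕ}

@[simp] theorem intVec_apply (r : Fin d → ℤ) (i : Fin d) : intVec r i = (r i : ℝ) := rfl

@[simp] theorem intVec_zero : intVec (0 : Fin d → ℤ) = 0 := by ext i; simp

theorem intVec_add (r s : Fin d → ℤ) : intVec (r + s) = intVec r + intVec s := by
  ext i; simp

theorem intVec_neg (r : Fin d → ℤ) : intVec (-r) = -intVec r := by ext i; simp

/-- Every point is within `√d` of the lattice. -/
theorem exists_intVec_near (x : Config d) : ∃ r : Fin d → ℤ, ‖x - intVec r‖ ≤ √d := by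
  refine ⟨fun i => ⌊x i⌋, ?_⟩
  rw [EuclideanSpace.norm_eq]
  refine Real.sqrt_le_sqrt ?_
  calc ∑ i, ‖(x - intVec fun i => ⌊x i⌋) i‖ ^ 2 ≤ ∑ _i : Fin d, (1 : ℝ) := by
        refine Finset.sum_le_sum fun i _ => ?_
        have h1 := Int.floor_le (x i)
        have h2 := Int.lt_floor_add_one (x i)
        have h3 : (x - intVec fun i => ⌊x i⌋) i = x i - ⌊x i⌋ := by simp
        rw [h3, Real.norm_eq_abs, sq_abs]
        nlinarith
    _ = d := by simp

/-- A continuous function on `ℝ^d` that is invariant under the lattice is bounded. -/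
theorem exists_bound_of_periodic {F : Type*} [NormedAddCommGroup F] {f : Config d → F}
    (hf : Continuous f)
    (hp : ∀ (r : Fin d → ℤ) x, f (x + intVec r) = f x) : ∃ C, ∀ x, ‖f x‖ ≤ C := by
  obtain ⟨C, hC⟩ := (isCompact_closedBall (0 : Config d) √d).exists_bound_of_continuousOn
    hf.continuousOn
  refine ⟨C, fun x => ?_⟩
  obtain ⟨r, hr⟩ := exists_intVec_near x
  have := hC (x - intVec r) (by simpa using hr)
  rwa [← hp r, sub_add_cancel] at this

end Lattice

namespace GeneratingFunction

variable {d : ℕ} (S : GeneratingFunction d)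

theorem hasFDerivAt (q : Config d × Config d) :
    HasFDerivAt S.toFun (fderiv ℝ S.toFun q) q :=
  (S.contDiff.differentiable (by norm_num) q).hasFDerivAt

theorem contDiff_fderiv : ContDiff ℝ 1 (fderiv ℝ S.toFun) :=
  S.contDiff.fderiv_right (m := 1) (by norm_num)

theorem continuous_fderiv : Continuous (fderiv ℝ S.toFun) := S.contDiff_fderiv.continuous

theorem continuous_fderiv_fderiv : Continuous (fderiv ℝ (fderiv ℝ S.toFun)) :=
  S.contDiff_fderiv.continuous_fderiv (by norm_num)

theorem fderiv_fderiv_symm (q a b : Config d × Config d) :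
    fderiv ℝ (fderiv ℝ S.toFun) q a b = fderiv ℝ (fderiv ℝ S.toFun) q b a :=
  S.contDiff.contDiffAt.isSymmSndFDerivAt (x := q) (by simp) a b

theorem fderiv_periodic (r : Fin d → ℤ) (x y : Config d) :
    fderiv ℝ S.toFun (x + intVec r, y + intVec r) = fderiv ℝ S.toFun (x, y) := by
  have h : (fun q : Config d × Config d => S.toFun (q + (intVec r, intVec r))) = S.toFun :=
    funext fun q => S.periodic r q.1 q.2
  have h1 := fderiv_comp_add_right (𝕜 := ℝ) (f := S.toFun) (x := (x, y)) (intVec r, intVec r)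
  rw [h] at h1
  exact h1.symm

theorem partialFst_periodic (r : Fin d → ℤ) (x y : Config d) :
    partialFst S.toFun (x + intVec r) (y + intVec r) = partialFst S.toFun x y := by
  rw [partialFst, fderiv_periodic, partialFst]

theorem partialSnd_periodic (r : Fin d → ℤ) (x y : Config d) :
    partialSnd S.toFun (x + intVec r) (y + intVec r) = partialSnd S.toFun x y := by
  rw [partialSnd, fderiv_periodic, partialSnd]

/-- The mean value theorem in the first variable, from `y` to `x`, integrates the twist inequality.
The comparison is with the diagonal because `∂₂S` is bounded there by periodicity. -/
theorem partialSnd_ge {A : ℝ}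
    (hA : ∀ x y ξ : Config d, fderiv ℝ (fderiv ℝ S.toFun) (x, y) (ξ, 0) (0, ξ) ≤ -A * ‖ξ‖ ^ 2)
    (x y : Config d) :
    partialSnd S.toFun y y (y - x) + A * ‖y - x‖ ^ 2 ≤ partialSnd S.toFun x y (y - x) := by
  have hd : ∀ u : Config d, HasFDerivAt (fun u => fderiv ℝ S.toFun (u, y) (0, y - x))
      ((ContinuousLinearMap.apply ℝ ℝ (0, y - x)).comp
        ((fderiv ℝ (fderiv ℝ S.toFun) (u, y)).comp (.inl ℝ (Config d) (Config d)))) u := by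
    intro u
    have h1 := HasFDerivAt.comp (f := fun u => (u, y)) u (S.hasFDerivAt_fderiv (u, y))
      (hasFDerivAt_prodMk_left u y)
    exact (ContinuousLinearMap.apply ℝ ℝ ((0 : Config d), y - x)).hasFDerivAt.comp u h1
  obtain ⟨t, -, h⟩ := exists_segment_eq hd y x
  have h1 := hA (y + t • (x - y)) y (y - x)
  have h2 : ((x - y, 0) : Config d × Config d) = -(y - x, 0) := by simp
  simp only [ContinuousLinearMap.comp_apply, ContinuousLinearMap.inl_apply,
    ContinuousLinearMap.apply_apply] at h
  rw [h2, map_neg, neg_apply] at h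
  simp only [partialSnd, ContinuousLinearMap.comp_apply, ContinuousLinearMap.inr_apply]
  linarith

/-- Generating functions grow quadratically away from the diagonal. -/
theorem exists_quadratic_growth :
    ∃ a B : ℝ, 0 < a ∧ ∀ x y, a * ‖x - y‖ ^ 2 - B ≤ S.toFun (x, y) := by
  obtain ⟨A, hA, hT⟩ := S.twist
  obtain ⟨C₀, hC₀⟩ := exists_bound_of_periodic (f := fun x => S.toFun (x, x))
    (S.contDiff.continuous.comp (by fun_prop)) (fun r x => S.periodic r x x)
  obtain ⟨C, hC⟩ := exists_bound_of_periodic (f := fun x => partialSnd S.toFun x x)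
    ((S.continuous_fderiv.comp (by fun_prop : Continuous fun x : Config d => (x, x))).clm_comp
      continuous_const) (fun r x => S.partialSnd_periodic r x x)
  -- Integrating `partialSnd_ge` along the segment from `x` to `y` gives the coefficient `A / 2`,
  -- minus a linear term `C * ‖v‖`; completing the square in `h9` spends half of the quadratic term
  -- on the linear one.
  refine ⟨A / 4, C₀ + C ^ 2 / A, by positivity, fun x y => ?_⟩
  set v := y - x with hv
  have hd : ∀ t : ℝ, HasDerivAt (fun t : ℝ => S.toFun (x, x + t • v) + C * ‖v‖ * t
      - A * ‖v‖ ^ 2 / 2 * t ^ 2)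
      (partialSnd S.toFun x (x + t • v) v + C * ‖v‖ - A * ‖v‖ ^ 2 * t) t := by
    intro t
    have e1 := hasDerivAt_comp_line (f := fun y => S.toFun (x, y))
      (f' := fun y => partialSnd S.toFun x y)
      (fun u => (S.hasFDerivAt (x, u)).comp u (hasFDerivAt_prodMk_right x u)) x v t
    have e2 := (e1.add ((hasDerivAt_id t).const_mul (C * ‖v‖))).sub
      ((hasDerivAt_pow 2 t).const_mul (A * ‖v‖ ^ 2 / 2))
    exact e2.congr_deriv (by norm_num; ring)
  obtain ⟨t, ht, h⟩ := exists_hasDerivAt_eq_slope _ _ (zero_lt_one)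
      (fun t _ => (hd t).continuousAt.continuousWithinAt) (fun t _ => hd t)
  have h1 := S.partialSnd_ge hT x (x + t • v)
  have h2 := (partialSnd S.toFun (x + t • v) (x + t • v)).le_of_opNorm_le
    (hC (x + t • v)) v
  rw [Real.norm_eq_abs] at h2
  have h3 := neg_abs_le (partialSnd S.toFun (x + t • v) (x + t • v) v)
  rw [add_sub_cancel_left, map_smul, map_smul, norm_smul, Real.norm_eq_abs, abs_of_pos ht.1,
    smul_eq_mul, smul_eq_mul] at h1
  have h4 : partialSnd S.toFun (x + t • v) (x + t • v) v + A * t * ‖v‖ ^ 2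
      ≤ partialSnd S.toFun x (x + t • v) v := by
    refine le_of_mul_le_mul_left ?_ ht.1
    linarith
  have h5 := hC₀ x
  rw [Real.norm_eq_abs] at h5
  have h6 := neg_abs_le (S.toFun (x, x))
  have h7 : x + v = y := by simp [hv]
  simp only [one_smul, zero_smul, add_zero, sub_zero, div_one, one_pow, mul_one, mul_zero,
    ne_eq, OfNat.ofNat_ne_zero, not_false_eq_true, zero_pow, h7] at h
  have h8 : ‖x - y‖ = ‖v‖ := by rw [norm_sub_rev]
  rw [h8]
  have h9 : C * ‖v‖ ≤ A / 4 * ‖v‖ ^ 2 + C ^ 2 / A := by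
    have : A / 4 * ‖v‖ ^ 2 + C ^ 2 / A - C * ‖v‖ = (A * ‖v‖ - 2 * C) ^ 2 / (4 * A) := by
      field_simp; ring
    have h10 : 0 ≤ (A * ‖v‖ - 2 * C) ^ 2 / (4 * A) := by positivity
    linarith
  linarith

/-! ### The differential of the twist map -/

theorem hasStrictFDerivAt_fderiv (q : Config d × Config d) :
    HasStrictFDerivAt (fderiv ℝ S.toFun) (fderiv ℝ (fderiv ℝ S.toFun) q) q :=
  S.contDiff_fderiv.contDiffAt.hasStrictFDerivAt (by norm_num)

theorem eq_zero_of_mixed_eq_zero (q : Config d × Config d) (ξ : Config d)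
    (h : fderiv ℝ (fderiv ℝ S.toFun) q (ξ, 0) (0, ξ) = 0) : ξ = 0 := by
  obtain ⟨A, hA, hT⟩ := S.twist
  have h1 := hT q.1 q.2 ξ
  rw [show (q.1, q.2) = q from rfl, h] at h1
  have h2 : ‖ξ‖ ^ 2 ≤ 0 := by nlinarith
  simpa using le_antisymm h2 (sq_nonneg _)

/-- The differential of the twist map, in terms of the second differential of the generating
function: it is the map that is implicitly defined by the linearized relations. -/
theorem exists_hasFDerivAt_twistMap (q : Phase d) :
    ∃ L : Phase d →L[ℝ] Phase d, HasFDerivAt S.twistMap L q ∧ Function.Injective L ∧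
      ∀ ξ ξ' : Config d,
        L (ξ, -(fderiv ℝ (fderiv ℝ S.toFun) (q.1, (S.twistMap q).1) (ξ, ξ')).comp
            (.inl ℝ (Config d) (Config d))) =
          (ξ', (fderiv ℝ (fderiv ℝ S.toFun) (q.1, (S.twistMap q).1) (ξ, ξ')).comp
            (.inr ℝ (Config d) (Config d))) := by
  set a : Config d × Config d := (q.1, (S.twistMap q).1) with ha
  set H := fderiv ℝ (fderiv ℝ S.toFun) a with hH
  let C1 := (ContinuousLinearMap.compL ℝ (Config d) (Config d × Config d) ℝ).flip
    (ContinuousLinearMap.inl ℝ (Config d) (Config d))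
  let C2 := (ContinuousLinearMap.compL ℝ (Config d) (Config d × Config d) ℝ).flip
    (ContinuousLinearMap.inr ℝ (Config d) (Config d))
  -- In the coordinates `(x, x')` the twist map is `Ψ ∘ Φ⁻¹`. The twist makes both differentials
  -- injective: a kernel vector has one zero component, and the mixed second derivative kills the
  -- other.
  let Φ : Config d × Config d → Phase d := fun b => (b.1, -partialFst S.toFun b.1 b.2)
  let Ψ : Config d × Config d → Phase d := fun b => (b.2, partialSnd S.toFun b.1 b.2)
  let Φ' : Config d × Config d →L[ℝ] Phase d :=
    (ContinuousLinearMap.fst ℝ _ _).prod (-(C1.comp H))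
  let Ψ' : Config d × Config d →L[ℝ] Phase d :=
    (ContinuousLinearMap.snd ℝ _ _).prod (C2.comp H)
  have hΦ : HasStrictFDerivAt Φ Φ' a :=
    hasStrictFDerivAt_fst.prodMk
      (C1.hasStrictFDerivAt.comp a (S.hasStrictFDerivAt_fderiv a)).fun_neg
  have hΨ : HasStrictFDerivAt Ψ Ψ' a :=
    hasStrictFDerivAt_snd.prodMk (C2.hasStrictFDerivAt.comp a (S.hasStrictFDerivAt_fderiv a))
  have injΦ : Function.Injective Φ' := by
    rw [injective_iff_map_eq_zero]
    rintro ⟨ξ, ξ'⟩ h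
    have h1 : ξ = 0 := congrArg Prod.fst h
    have h2 : -(C1 (H (ξ, ξ'))) = 0 := congrArg Prod.snd h
    subst h1
    have h3 := DFunLike.congr_fun (neg_eq_zero.1 h2) ξ'
    have h4 : H (0, ξ') (ξ', 0) = 0 := h3
    rw [hH, S.fderiv_fderiv_symm] at h4
    rw [S.eq_zero_of_mixed_eq_zero a ξ' h4]
    rfl
  have injΨ : Function.Injective Ψ' := by
    rw [injective_iff_map_eq_zero]
    rintro ⟨ξ, ξ'⟩ h
    have h1 : ξ' = 0 := congrArg Prod.fst h
    have h2 : C2 (H (ξ, ξ')) = 0 := congrArg Prod.snd h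
    subst h1
    have h3 := DFunLike.congr_fun h2 ξ
    have h4 : H (ξ, 0) (0, ξ) = 0 := h3
    rw [S.eq_zero_of_mixed_eq_zero a ξ h4]
    rfl
  have hdim : Module.finrank ℝ (Config d × Config d) = Module.finrank ℝ (Phase d) := by
    have : Module.finrank ℝ (Config d) = Module.finrank ℝ (StrongDual ℝ (Config d)) :=
      LinearEquiv.finrank_eq
        ({ toFun := InnerProductSpace.toDual ℝ (Config d)
           map_add' := fun x y => map_add _ x y
           map_smul' := fun (c : ℝ) x => by simp
           invFun := (InnerProductSpace.toDual ℝ (Config d)).symm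
           left_inv := fun x => by simp
           right_inv := fun x => by simp } : Config d ≃ₗ[ℝ] StrongDual ℝ (Config d))
    rw [Module.finrank_prod, Module.finrank_prod, this]
  let e : (Config d × Config d) ≃L[ℝ] Phase d :=
    (LinearMap.linearEquivOfInjective (Φ' : Config d × Config d →ₗ[ℝ] Phase d) injΦ
      hdim).toContinuousLinearEquiv
  have he : (e : Config d × Config d →L[ℝ] Phase d) = Φ' :=
    ContinuousLinearMap.ext fun b => rfl
  have hg : ∀ b, (fun p : Phase d => (p.1, S.next p)) (Φ b) = b := fun b =>
    Prod.ext rfl ((S.bijective_partialFst b.1).1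
      ((S.partialFst_next (Φ b)).trans (neg_neg _)))
  have hqa : Φ a = q := Prod.ext rfl (by
    change -partialFst S.toFun q.1 (S.next q) = q.2
    rw [S.partialFst_next, neg_neg])
  have hg' : HasStrictFDerivAt (fun p : Phase d => (p.1, S.next p))
      (e.symm : Phase d →L[ℝ] Config d × Config d) q := by
    -- A left inverse of a map with invertible strict differential is differentiable, so continuity
    -- of `next` need not be known beforehand.
    have := HasStrictFDerivAt.to_local_left_inverse (f' := e) (f := Φ)
      (g := fun p : Phase d => (p.1, S.next p)) (a := a) (by rw [he]; exact hΦ)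
      (Filter.Eventually.of_forall hg)
    rwa [hqa] at this
  refine ⟨Ψ'.comp (e.symm : Phase d →L[ℝ] Config d × Config d), ?_, ?_, ?_⟩
  · exact (hΨ.comp (f := fun p : Phase d => (p.1, S.next p)) q hg').hasFDerivAt
  · exact injΨ.comp e.symm.injective
  · intro ξ ξ'
    have h1 : e (ξ, ξ') = (ξ, -(H (ξ, ξ')).comp (.inl ℝ (Config d) (Config d))) := rfl
    rw [← h1]
    simp only [ContinuousLinearMap.comp_apply, ContinuousLinearEquiv.coe_coe,
      ContinuousLinearEquiv.symm_apply_apply]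
    rfl

theorem differentiable_twistMap : Differentiable ℝ S.twistMap := fun q => by
  obtain ⟨L, hL, -⟩ := S.exists_hasFDerivAt_twistMap q
  exact hL.differentiableAt

/-! ### Orbits -/

/-- The positions along the orbit of a point. -/
noncomputable def orbit (q : Phase d) (k : ℕ) : Config d := (S.twistMap^[k] q).1

theorem iterate_snd_eq (q : Phase d) (k : ℕ) :
    (S.twistMap^[k] q).2 = -partialFst S.toFun (S.orbit q k) (S.orbit q (k + 1)) ∧
      (S.twistMap^[k + 1] q).2 = partialSnd S.toFun (S.orbit q k) (S.orbit q (k + 1)) := by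
  have h : S.twistMap (S.twistMap^[k] q) = S.twistMap^[k + 1] q :=
    (Function.iterate_succ_apply' _ _ _).symm
  exact (S.twistMap_eq_iff _ _ _ _).1 h

theorem orbit_zero (q : Phase d) : S.orbit q 0 = q.1 := rfl

/-- Orbits are critical. -/
theorem orbit_critical (q : Phase d) (k : ℕ) :
    partialSnd S.toFun (S.orbit q k) (S.orbit q (k + 1)) +
      partialFst S.toFun (S.orbit q (k + 1)) (S.orbit q (k + 2)) = 0 := by
  rw [← (S.iterate_snd_eq q k).2, (S.iterate_snd_eq q (k + 1)).1]
  simp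

/-- Critical sequences are orbits. -/
theorem orbit_eq_of_critical {n : ℕ} {w : ℕ → Config d}
    (hw : ∀ k, k + 1 < n → partialSnd S.toFun (w k) (w (k + 1)) +
      partialFst S.toFun (w (k + 1)) (w (k + 2)) = 0) {k : ℕ} (hk : k ≤ n) :
    S.orbit (w 0, -partialFst S.toFun (w 0) (w 1)) k = w k := by
  have key : ∀ k, k < n → S.twistMap^[k] (w 0, -partialFst S.toFun (w 0) (w 1)) =
      (w k, -partialFst S.toFun (w k) (w (k + 1))) := by
    intro k hk
    induction k with
    | zero => rfl
    | succ k ih =>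
      rw [Function.iterate_succ_apply', ih (by omega), twistMap_eq_iff]
      exact ⟨rfl, (eq_neg_of_add_eq_zero_left (hw k hk)).symm⟩
  rcases k with _ | k
  · rfl
  · rw [orbit, Function.iterate_succ_apply', key k (by omega)]
    have : S.twistMap (w k, -partialFst S.toFun (w k) (w (k + 1))) =
      (w (k + 1), partialSnd S.toFun (w k) (w (k + 1))) :=
      (S.twistMap_eq_iff _ _ _ _).2 ⟨rfl, rfl⟩
    rw [this]

theorem twistMap_add_intVec (q : Phase d) (r : Fin d → ℤ) :
    S.twistMap (q + (intVec r, 0)) = S.twistMap q + (intVec r, 0) := by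
  have h := (S.twistMap_eq_iff q.1 (S.twistMap q).1 q.2 (S.twistMap q).2).1 rfl
  have : S.twistMap (q.1 + intVec r, q.2) =
      ((S.twistMap q).1 + intVec r, (S.twistMap q).2) := by
    rw [twistMap_eq_iff, partialFst_periodic, partialSnd_periodic]
    exact h
  have h1 : q + (intVec r, 0) = (q.1 + intVec r, q.2) := Prod.ext rfl (add_zero _)
  have h2 : S.twistMap q + (intVec r, 0) =
    ((S.twistMap q).1 + intVec r, (S.twistMap q).2) := Prod.ext rfl (add_zero _)
  rw [h1, this, h2]

theorem orbit_add_intVec (q : Phase d) (r : Fin d → ℤ) (k : ℕ) :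
    S.orbit (q + (intVec r, 0)) k = S.orbit q k + intVec r := by
  have : S.twistMap^[k] (q + (intVec r, 0)) = S.twistMap^[k] q + (intVec r, 0) := by
    induction k with
    | zero => rfl
    | succ k ih =>
      rw [Function.iterate_succ_apply', ih, twistMap_add_intVec, Function.iterate_succ_apply']
  rw [orbit, this]
  rfl

theorem orbit_add_period {q : Phase d} {n : ℕ} {r : Fin d → ℤ}
    (h : S.twistMap^[n] q = q + (intVec r, 0)) (k : ℕ) :
    S.orbit q (k + n) = S.orbit q k + intVec r := by
  rw [← orbit_add_intVec, ← h, orbit, Function.iterate_add_apply]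
  rfl

theorem continuous_orbit (k : ℕ) : Continuous fun q => S.orbit q k :=
  continuous_fst.comp (S.differentiable_twistMap.continuous.iterate k)

variable {S}

/-- Without conjugate points a Jacobi field along an orbit that vanishes at two different times
is zero. -/
theorem WithoutConjugatePoints.jacobi_eq_zero (hS : S.WithoutConjugatePoints) (q : Phase d)
    {n : ℕ} (hn : n ≠ 0) {ξ : ℕ → Config d} (h0 : ξ 0 = 0) (hξn : ξ n = 0)
    (hξ : ∀ k, k + 1 < n →
      (fderiv ℝ (fderiv ℝ S.toFun) (S.orbit q k, S.orbit q (k + 1)) (ξ k, ξ (k + 1))).comp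
          (.inr ℝ (Config d) (Config d)) +
        (fderiv ℝ (fderiv ℝ S.toFun) (S.orbit q (k + 1), S.orbit q (k + 2))
          (ξ (k + 1), ξ (k + 2))).comp (.inl ℝ (Config d) (Config d)) = 0)
    {k : ℕ} (hk : k ≤ n) : ξ k = 0 := by
  choose L hL hinj hrel using S.exists_hasFDerivAt_twistMap
  -- The chain rule is stated for an arbitrary differential `M'` of the next iterate, so that it
  -- links the differentials picked independently by `choose`.
  have hpow : ∀ k, ∃ M : Phase d →L[ℝ] Phase d, HasFDerivAt S.twistMap^[k] M q ∧
      Function.Injective M ∧ (∀ v, ∀ M' : Phase d →L[ℝ] Phase d, HasFDerivAt S.twistMap^[k + 1] M' q →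
        M' v = L (S.twistMap^[k] q) (M v)) := by
    intro k
    induction k with
    | zero =>
      refine ⟨.id ℝ _, hasFDerivAt_id q, fun _ _ h => h, fun v M' hM' => ?_⟩
      rw [zero_add, Function.iterate_one] at hM'
      rw [hM'.unique (hL q)]
      rfl
    | succ k ih =>
      obtain ⟨M, hM, hMi, -⟩ := ih
      have h1 : HasFDerivAt S.twistMap^[k + 1] ((L (S.twistMap^[k] q)).comp M) q := by
        rw [Function.iterate_succ']
        exact (hL _).comp q hM
      refine ⟨_, h1, (hinj _).comp hMi, fun v M' hM' => ?_⟩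
      have h2 : HasFDerivAt S.twistMap^[k + 1 + 1]
          ((L (S.twistMap^[k + 1] q)).comp ((L (S.twistMap^[k] q)).comp M)) q := by
        rw [Function.iterate_succ']
        exact (hL _).comp q h1
      rw [hM'.unique h2]
      rfl
  choose M hM hMi hMs using hpow
  let η₀ : StrongDual ℝ (Config d) :=
    -(fderiv ℝ (fderiv ℝ S.toFun) (S.orbit q 0, S.orbit q 1) (ξ 0, ξ 1)).comp
      (.inl ℝ (Config d) (Config d))
  have hrel' : ∀ k, L (S.twistMap^[k] q)
      (ξ k, -(fderiv ℝ (fderiv ℝ S.toFun) (S.orbit q k, S.orbit q (k + 1))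
        (ξ k, ξ (k + 1))).comp (.inl ℝ (Config d) (Config d))) =
      (ξ (k + 1), (fderiv ℝ (fderiv ℝ S.toFun) (S.orbit q k, S.orbit q (k + 1))
        (ξ k, ξ (k + 1))).comp (.inr ℝ (Config d) (Config d))) := by
    intro k
    have h1 : (S.twistMap (S.twistMap^[k] q)).1 = S.orbit q (k + 1) := by
      rw [orbit, Function.iterate_succ_apply']
    have := hrel (S.twistMap^[k] q) (ξ k) (ξ (k + 1))
    rw [h1] at this
    exact this
  have hM0 : M 0 (0, η₀) = (0, η₀) := by
    rw [(hM 0).unique (hasFDerivAt_id q)]; rfl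
  have key : ∀ k, k < n → M k (0, η₀) =
      (ξ k, -(fderiv ℝ (fderiv ℝ S.toFun) (S.orbit q k, S.orbit q (k + 1))
        (ξ k, ξ (k + 1))).comp (.inl ℝ (Config d) (Config d))) := by
    intro k hk
    induction k with
    | zero => rw [hM0, h0]; simp only [η₀, h0]
    | succ k ih =>
      rw [hMs k _ _ (hM (k + 1)), ih (by omega), hrel']
      exact Prod.ext rfl (eq_neg_of_add_eq_zero_left (hξ k hk))
  have key' : ∀ k, k ≤ n → (M k (0, η₀)).1 = ξ k := by
    intro k hk
    rcases k with _ | k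
    · rw [hM0, h0]
    · rw [hMs k _ _ (hM (k + 1)), key k (by omega), hrel']
  have hc := hS q n (by exact_mod_cast hn)
  -- `(0, η₀)` is vertical, and so is its image since `ξ n = 0`. Thus the image is zero, and
  -- injectivity of the differential kills the initial momentum `η₀` and with it the whole field.
  have hz : M n (0, η₀) = 0 := by
    rw [← Submodule.mem_bot (R := ℝ), ← hc]
    refine ⟨?_, ⟨(0, η₀), rfl, ?_⟩⟩
    · change (M n (0, η₀)).1 = 0
      rw [key' n le_rfl, hξn]
    · have h1 : ⇑(S.twistMap ^ (n : ℤ)) = S.twistMap^[n] := by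
        rw [zpow_natCast, Equiv.Perm.iterate_eq_pow]
      rw [h1, (hM n).fderiv]
      rfl
  have hη : ((0 : Config d), η₀) = 0 := hMi n (hz.trans (map_zero _).symm)
  rw [← key' k hk, hη, map_zero]
  rfl

end GeneratingFunction
end TwistMap

/-! ### Finite sequences, their concatenation and their steps. -/

namespace TwistMap

section Paths

variable {d : ℕ} {L : Config d × Config d → ℝ}

/-- There is a sequence of `n` steps from `x` to `y` with action `a`. -/
def HasPath (L : Config d × Config d → ℝ) (n : ℕ) (x y : Config d) (a : ℝ) : Prop :=
  ∃ w : ℕ → Config d, w 0 = x ∧ w n = y ∧ action L n w = a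

theorem action_congr {n : ℕ} {w w' : ℕ → Config d} (h : ∀ k ≤ n, w k = w' k) :
    action L n w = action L n w' := by
  refine Finset.sum_congr rfl fun k hk => ?_
  have := Finset.mem_range.1 hk
  rw [h k (by omega), h (k + 1) (by omega)]

theorem action_add (n m : ℕ) (w : ℕ → Config d) :
    action L (n + m) w = action L n w + action L m fun k => w (n + k) := by
  rw [action, Finset.sum_range_add]
  rfl

theorem HasPath.single (x y : Config d) : HasPath L 1 x y (L (x, y)) :=
  ⟨fun k => if k = 0 then x else y, by simp, by simp, by simp [action]⟩

theorem HasPath.trans {n m : ℕ} {x y z : Config d} {a b : ℝ} (h1 : HasPath L n x y a)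
    (h2 : HasPath L m y z b) : HasPath L (n + m) x z (a + b) := by
  obtain ⟨w, hw0, hwn, hwa⟩ := h1
  obtain ⟨v, hv0, hvm, hvb⟩ := h2
  refine ⟨fun k => if k ≤ n then w k else v (k - n), by simpa using hw0, ?_, ?_⟩
  · rcases m.eq_zero_or_pos with rfl | hm
    · simp [hwn, ← hv0, hvm]
    · simp [hm.ne', hvm]
  · rw [action_add, ← hwa, ← hvb]
    congr 1
    · exact action_congr fun k hk => by simp [hk]
    · refine action_congr fun k _ => ?_
      rcases k.eq_zero_or_pos with rfl | hk
      · simp [hwn, hv0]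
      · simp [hk.ne']

theorem HasPath.translate (hL : ∀ (r : Fin d → ℤ) x y, L (x + intVec r, y + intVec r) = L (x, y))
    {n : ℕ} {x y : Config d} {a : ℝ} (h : HasPath L n x y a) (r : Fin d → ℤ) :
    HasPath L n (x + intVec r) (y + intVec r) a := by
  obtain ⟨w, rfl, rfl, rfl⟩ := h
  exact ⟨fun k => w k + intVec r, rfl, rfl, by simp [action, hL]⟩

theorem HasPath.iterate (hL : ∀ (r : Fin d → ℤ) x y, L (x + intVec r, y + intVec r) = L (x, y))
    {n : ℕ} {x : Config d} {r : Fin d → ℤ} {a : ℝ} (h : HasPath L n x (x + intVec r) a) (j : ℕ) :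
    HasPath L (j * n) x (x + intVec (j • r)) (j * a) := by
  induction j with
  | zero => exact ⟨fun _ => x, rfl, by simp, by simp [action]⟩
  | succ j ih =>
    have h1 := ih.trans (h.translate hL (j • r))
    have h2 : x + intVec r + intVec (j • r) = x + intVec ((j + 1) • r) := by
      rw [succ_nsmul, intVec_add]; abel
    rw [h2] at h1
    convert h1 using 1
    · ring
    · push_cast; ring

/-- If every step is at most `D`, the distance from the start is at most `k * D`. -/
theorem norm_le_of_steps {n : ℕ} {w : ℕ → Config d} {D : ℝ}
    (h : ∀ k < n, ‖w k - w (k + 1)‖ ≤ D) {k : ℕ} (hk : k ≤ n) : ‖w k‖ ≤ ‖w 0‖ + k * D := by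
  induction k with
  | zero => simp
  | succ k ih =>
    have h1 := ih (by omega)
    have h2 := h k (by omega)
    have h3 := norm_sub_le (w k) (w k - w (k + 1))
    rw [sub_sub_cancel] at h3
    push_cast
    linarith

/-- Quadratic growth bounds the steps of a sequence in terms of its action. -/
theorem sq_step_le {a B : ℝ} (ha : 0 < a) (hL : ∀ x y, a * ‖x - y‖ ^ 2 - B ≤ L (x, y))
    {n : ℕ} {w : ℕ → Config d} {k : ℕ} (hk : k < n) :
    a * ‖w k - w (k + 1)‖ ^ 2 ≤ action L n w + n * B := by
  have h1 : action L n w + n * B = ∑ k ∈ Finset.range n, (L (w k, w (k + 1)) + B) := by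
    simp [action, Finset.sum_add_distrib]
  rw [h1]
  have h2 : a * ‖w k - w (k + 1)‖ ^ 2 ≤ L (w k, w (k + 1)) + B := by
    have := hL (w k) (w (k + 1))
    linarith
  refine h2.trans (Finset.single_le_sum (f := fun k => L (w k, w (k + 1)) + B)
    (fun j _ => ?_) (Finset.mem_range.2 hk))
  have h3 := hL (w j) (w (j + 1))
  have h4 : 0 ≤ a * ‖w j - w (j + 1)‖ ^ 2 := by positivity
  linarith

end Paths

end TwistMap

/-! ### Derivatives of finite sums of compositions with linear maps. -/

namespace TwistMap

section SumOfCompositions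

variable {V E : Type*} [NormedAddCommGroup V] [NormedSpace ℝ V] [NormedAddCommGroup E]
  [NormedSpace ℝ E] {f : E → ℝ} {f' : E → StrongDual ℝ E} {f'' : E → E →L[ℝ] StrongDual ℝ E}

/-- The second differential of `v ↦ ∑ k ∈ s, f (T k v)`. -/
noncomputable def sumComp'' (f'' : E → E →L[ℝ] StrongDual ℝ E) (T : ℕ → V →L[ℝ] E)
    (s : Finset ℕ) (v : V) : V →L[ℝ] StrongDual ℝ V :=
  ∑ k ∈ s, ((ContinuousLinearMap.compL ℝ V E ℝ).flip (T k)).comp ((f'' (T k v)).comp (T k))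

theorem sumComp''_apply (T : ℕ → V →L[ℝ] E) (s : Finset ℕ) (v ξ ζ : V) :
    sumComp'' f'' T s v ξ ζ = ∑ k ∈ s, f'' (T k v) (T k ξ) (T k ζ) := by
  simp only [sumComp'', sum_apply]
  rfl

theorem hasFDerivAt_sum_comp (hf : ∀ u, HasFDerivAt f (f' u) u) (T : ℕ → V →L[ℝ] E)
    (s : Finset ℕ) (v : V) :
    HasFDerivAt (fun v => ∑ k ∈ s, f (T k v)) (∑ k ∈ s, (f' (T k v)).comp (T k)) v :=
  HasFDerivAt.fun_sum fun k _ =>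
    HasFDerivAt.comp (f := T k) v (hf (T k v)) (T k).hasFDerivAt

theorem hasFDerivAt_sum_comp' (hf : ∀ u, HasFDerivAt f' (f'' u) u) (T : ℕ → V →L[ℝ] E)
    (s : Finset ℕ) (v : V) :
    HasFDerivAt (fun v => ∑ k ∈ s, (f' (T k v)).comp (T k)) (sumComp'' f'' T s v) v :=
  HasFDerivAt.fun_sum fun k _ =>
    ((ContinuousLinearMap.compL ℝ V E ℝ).flip (T k)).hasFDerivAt.comp v
      (HasFDerivAt.comp (f := T k) v (hf (T k v)) (T k).hasFDerivAt)

theorem continuous_sum_of_normed {X G : Type*} [TopologicalSpace X] [NormedAddCommGroup G]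
    {f : ℕ → X → G} (s : Finset ℕ) (h : ∀ k ∈ s, Continuous (f k)) :
    Continuous fun x => ∑ k ∈ s, f k x :=
  continuous_finsetSum s h

theorem continuous_sumComp'' (hf : Continuous f'') (T : ℕ → V →L[ℝ] E) (s : Finset ℕ) :
    Continuous (sumComp'' f'' T s) :=
  continuous_sum_of_normed (G := V →L[ℝ] StrongDual ℝ V) _ fun k _ => continuous_const.clm_comp
    ((hf.comp (T k).continuous).clm_comp continuous_const)

end SumOfCompositions

theorem hasFDerivAt_slice {E P G : Type*} [NormedAddCommGroup E] [NormedSpace ℝ E]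
    [NormedAddCommGroup P] [NormedSpace ℝ P] [NormedAddCommGroup G] [NormedSpace ℝ G]
    {f : E × P → G} {f' : E × P →L[ℝ] G} {e : E} {u : P} (h : HasFDerivAt f f' (e, u)) :
    HasFDerivAt (fun u => f (e, u)) (f'.comp (.inr ℝ E P)) u :=
  h.comp u (hasFDerivAt_prodMk_right e u)

/-! ### Positivity in connected families of quadratic forms. -/

section Families

/-- In a continuous family of forms over a connected space, all of whose positive semidefinite
members are positive definite, either all or no members are positive definite. -/
theorem pos_of_connected {X E : Type*} [TopologicalSpace X] [PreconnectedSpace X]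
    [NormedAddCommGroup E] [NormedSpace ℝ E] [FiniteDimensional ℝ E]
    {B : X → E →L[ℝ] StrongDual ℝ E} (hB : Continuous B)
    (hpos : ∀ q, (∀ ξ, 0 ≤ B q ξ ξ) → ∀ ξ, ξ ≠ 0 → 0 < B q ξ ξ)
    {q₀ : X} (h₀ : ∀ ξ, 0 ≤ B q₀ ξ ξ) (q : X) {ξ : E} (hξ : ξ ≠ 0) : 0 < B q ξ ξ := by
  have hnorm : ∀ {G : Type _} [NormedAddCommGroup G] {f : X → G} (_ : Continuous f) (x : X)
      {a : ℝ} (_ : 0 < a), ∀ᶠ x' in nhds x, ‖f x' - f x‖ < a := fun hf x a ha =>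
    ((hf.sub continuous_const).norm.tendsto x).eventually_lt_const (by simpa using ha)
  have hclosed : IsClosed {q | ∀ ξ, 0 ≤ B q ξ ξ} := by
    rw [Set.ofPred_forall]
    exact isClosed_iInter fun ξ => isClosed_le continuous_const
      ((hB.clm_apply continuous_const).clm_apply continuous_const)
  -- Semidefinite members are uniformly positive with some constant `a`, which survives a
  -- perturbation of norm less than `a`.
  have hopen : IsOpen {q | ∀ ξ, 0 ≤ B q ξ ξ} := by
    rw [isOpen_iff_mem_nhds]
    intro q hq
    obtain ⟨a, ha, haB⟩ := exists_pos_mul_sq_le _ (hpos q hq)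
    filter_upwards [hnorm (G := E →L[ℝ] StrongDual ℝ E) hB q ha] with q' h2 ξ
    have h3 := (B q' - B q).le_opNorm₂ ξ ξ
    have h4 : (B q' - B q) ξ ξ = B q' ξ ξ - B q ξ ξ := rfl
    rw [h4, Real.norm_eq_abs] at h3
    have h5 := neg_abs_le (B q' ξ ξ - B q ξ ξ)
    have h6 := haB ξ
    have h7 : ‖B q' - B q‖ * ‖ξ‖ * ‖ξ‖ ≤ a * ‖ξ‖ * ‖ξ‖ := by gcongr
    nlinarith
  have huniv := IsClopen.eq_univ ⟨hclosed, hopen⟩ ⟨q₀, h₀⟩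
  exact hpos q (huniv ▸ Set.mem_univ q : q ∈ {q | ∀ ξ, 0 ≤ B q ξ ξ}) ξ hξ

end Families

/-! ### Sequences as points of a Euclidean space, split into end points and interior points. -/

section PathSpace

open Bornology

/-- The Euclidean space of the interior points of sequences with `m` interior points. -/
def PathSpace (d m : ℕ) : Type := PiLp 2 fun _ : Fin m => Config d

noncomputable instance (d m : ℕ) : NormedAddCommGroup (PathSpace d m) :=
  inferInstanceAs (NormedAddCommGroup (PiLp 2 fun _ : Fin m => Config d))

noncomputable instance (d m : ℕ) : InnerProductSpace ℝ (PathSpace d m) :=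
  inferInstanceAs (InnerProductSpace ℝ (PiLp 2 fun _ : Fin m => Config d))

/-- The coordinates of a point of the path space. -/
noncomputable def PathSpace.equiv (d m : ℕ) : PathSpace d m ≃L[ℝ] (Fin m → Config d) :=
  PiLp.continuousLinearEquiv 2 ℝ fun _ : Fin m => Config d

instance (d m : ℕ) : FiniteDimensional ℝ (PathSpace d m) :=
  (PathSpace.equiv d m).symm.toLinearEquiv.finiteDimensional

/-- Sequences with `m` interior points, as a pair of end points and the interior points. -/
abbrev FullPath (d m : ℕ) : Type := (Config d × Config d) × PathSpace d m

variable {d : ℕ} (m : ℕ)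

/-- The `k`-th point of a sequence. -/
noncomputable def node (k : ℕ) : FullPath d m →L[ℝ] Config d :=
  if k = 0 then (ContinuousLinearMap.fst ℝ _ _).comp (ContinuousLinearMap.fst ℝ _ _)
  else if h : k - 1 < m then
    (ContinuousLinearMap.proj (R := ℝ) (φ := fun _ : Fin m => Config d) ⟨k - 1, h⟩).comp
      ((PathSpace.equiv d m : PathSpace d m →L[ℝ] Fin m → Config d).comp
        (ContinuousLinearMap.snd ℝ _ _))
  -- Default branch: every index beyond `m` reads the last end point; only `m + 1` matters.
  else (ContinuousLinearMap.snd ℝ _ _).comp (ContinuousLinearMap.fst ℝ _ _)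

/-- The `k`-th step of a sequence. -/
noncomputable def edge (k : ℕ) : FullPath d m →L[ℝ] Config d × Config d :=
  (node m k).prod (node m (k + 1))

/-- The sequence of `m + 1` steps that starts like a given infinite sequence. -/
noncomputable def ofSeq (w : ℕ → Config d) : FullPath d m :=
  ((w 0, w (m + 1)), (PathSpace.equiv d m).symm fun i : Fin m => w (i + 1))

theorem node_zero (v : FullPath d m) : node m 0 v = v.1.1 := by simp [node]

theorem node_last (v : FullPath d m) : node m (m + 1) v = v.1.2 := by simp [node]

theorem node_succ (v : FullPath d m) (i : Fin m) : node m (i + 1) v = PathSpace.equiv d m v.2 i := by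
  simp [node]

theorem node_ofSeq (w : ℕ → Config d) {k : ℕ} (hk : k ≤ m + 1) :
    node m k (ofSeq m w) = w k := by
  rcases k with _ | k
  · exact node_zero m _
  · rcases (Nat.lt_or_ge k m) with h | h
    · rw [node_succ m _ ⟨k, h⟩, ofSeq, ContinuousLinearEquiv.apply_symm_apply]
    · obtain rfl : k = m := by omega
      exact node_last k _

theorem ofSeq_node (v : FullPath d m) : ofSeq m (fun k => node m k v) = v := by
  refine Prod.ext (Prod.ext (node_zero m v) (node_last m v)) ?_
  rw [ofSeq, ContinuousLinearEquiv.symm_apply_eq]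
  exact funext fun i => node_succ m v i

theorem ofSeq_congr {w w' : ℕ → Config d} (h : ∀ k ≤ m + 1, w k = w' k) :
    ofSeq m w = ofSeq m w' := by
  rw [ofSeq, ofSeq, h 0 (by omega), h (m + 1) le_rfl]
  congr 2
  exact funext fun i => h _ (by omega)

/-- Summation by parts. -/
theorem sum_edges (P Q : ℕ → StrongDual ℝ (Config d)) (ζ : ℕ → Config d) :
    ∑ k ∈ Finset.range (m + 1), (P k (ζ k) + Q k (ζ (k + 1))) =
      P 0 (ζ 0) + Q m (ζ (m + 1)) + ∑ k ∈ Finset.range m, (Q k + P (k + 1)) (ζ (k + 1)) := by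
  simp only [Finset.sum_add_distrib, add_apply]
  rw [Finset.sum_range_succ' (fun k => P k (ζ k)), Finset.sum_range_succ (fun k => Q k (ζ (k + 1)))]
  ring

/-- Interior points vary independently, so test vectors supported at one node split an equation on
path space into one equation per node: Euler–Lagrange for the differential, Jacobi for the Hessian.
-/
theorem eq_zero_of_sum_eq_zero {R : ℕ → StrongDual ℝ (Config d)}
    (h : ∀ ζ : PathSpace d m, ∑ k ∈ Finset.range m, R k (node m (k + 1) (0, ζ)) = 0)
    {k : ℕ} (hk : k < m) : R k = 0 := by
  ext1 a
  let ζ : PathSpace d m := (PathSpace.equiv d m).symm fun i => if (i : ℕ) = k then a else 0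
  have h1 := h ζ
  rw [Finset.sum_eq_single k] at h1
  · have : node m (k + 1) ((0 : Config d × Config d), ζ) = a := by
      rw [node_succ m _ ⟨k, hk⟩]; simp [ζ]
    rwa [this] at h1
  · intro j hj hjk
    have : node m (j + 1) ((0 : Config d × Config d), ζ) = 0 := by
      rw [node_succ m _ ⟨j, Finset.mem_range.1 hj⟩]; simp [ζ, hjk]
    rw [this, map_zero]
  · intro hk'
    exact absurd (Finset.mem_range.2 hk) hk'

end PathSpace

/-! ### The action on path space: critical points, Hessian, minimality of orbits. -/

namespace GeneratingFunction

open Bornology Filter Topology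

variable {d : ℕ} (S : GeneratingFunction d) (m : ℕ)

/-- The action as a function on the space of sequences of `m + 1` steps. -/
noncomputable def pathAction (v : FullPath d m) : ℝ :=
  action S.toFun (m + 1) fun k => node m k v

/-- The differential of the action. -/
noncomputable def pathAction' (v : FullPath d m) : StrongDual ℝ (FullPath d m) :=
  ∑ k ∈ Finset.range (m + 1), (fderiv ℝ S.toFun (edge m k v)).comp (edge m k)

/-- The second differential of the action. -/
noncomputable def pathAction'' (v : FullPath d m) :
    FullPath d m →L[ℝ] StrongDual ℝ (FullPath d m) :=
  sumComp'' (fderiv ℝ (fderiv ℝ S.toFun)) (edge m) (Finset.range (m + 1)) v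

theorem pathAction_ofSeq (w : ℕ → Config d) :
    S.pathAction m (ofSeq m w) = action S.toFun (m + 1) w :=
  action_congr fun _ hk => node_ofSeq m w hk

theorem hasFDerivAt_pathAction (v : FullPath d m) :
    HasFDerivAt (S.pathAction m) (S.pathAction' m v) v :=
  hasFDerivAt_sum_comp S.hasFDerivAt (edge m) (Finset.range (m + 1)) v

theorem hasFDerivAt_pathAction' (v : FullPath d m) :
    HasFDerivAt (S.pathAction' m) (S.pathAction'' m v) v :=
  hasFDerivAt_sum_comp' S.hasFDerivAt_fderiv (edge m) _ v

theorem continuous_pathAction : Continuous (S.pathAction m) :=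
  continuous_iff_continuousAt.2 fun v => (S.hasFDerivAt_pathAction m v).continuousAt

theorem continuous_pathAction' : Continuous (S.pathAction' m) :=
  continuous_iff_continuousAt.2 fun v => (S.hasFDerivAt_pathAction' m v).continuousAt

theorem continuous_pathAction'' : Continuous (S.pathAction'' m) :=
  continuous_sumComp'' S.continuous_fderiv_fderiv (edge m) _

theorem pathAction'_apply (v ζ : FullPath d m) :
    S.pathAction' m v ζ =
      partialFst S.toFun (node m 0 v) (node m 1 v) (node m 0 ζ) +
        partialSnd S.toFun (node m m v) (node m (m + 1) v) (node m (m + 1) ζ) +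
        ∑ k ∈ Finset.range m, (partialSnd S.toFun (node m k v) (node m (k + 1) v) +
          partialFst S.toFun (node m (k + 1) v) (node m (k + 2) v)) (node m (k + 1) ζ) := by
  rw [← sum_edges m (fun k => partialFst S.toFun (node m k v) (node m (k + 1) v))
    (fun k => partialSnd S.toFun (node m k v) (node m (k + 1) v)) (fun k => node m k ζ)]
  simp only [pathAction', sum_apply]
  refine Finset.sum_congr rfl fun k _ => ?_
  simp only [partialFst, partialSnd, ContinuousLinearMap.comp_apply,
    ContinuousLinearMap.inl_apply, ContinuousLinearMap.inr_apply, ← map_add]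
  simp [edge]

theorem pathAction''_apply (v ξ ζ : FullPath d m) :
    S.pathAction'' m v ξ ζ = ∑ k ∈ Finset.range (m + 1),
      fderiv ℝ (fderiv ℝ S.toFun) (edge m k v) (edge m k ξ) (edge m k ζ) :=
  sumComp''_apply _ _ _ _ _

/-- The second differential of the action with fixed end points. -/
noncomputable def interiorHessian (v : FullPath d m) :
    PathSpace d m →L[ℝ] StrongDual ℝ (PathSpace d m) :=
  ((ContinuousLinearMap.compL ℝ (PathSpace d m) (FullPath d m) ℝ).flip
    (.inr ℝ (Config d × Config d) (PathSpace d m))).comp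
      ((S.pathAction'' m v).comp (.inr ℝ (Config d × Config d) (PathSpace d m)))

theorem interiorHessian_apply (v : FullPath d m) (ξ ζ : PathSpace d m) :
    S.interiorHessian m v ξ ζ = S.pathAction'' m v (0, ξ) (0, ζ) := rfl

theorem continuous_interiorHessian : Continuous (S.interiorHessian m) :=
  continuous_const.clm_comp ((S.continuous_pathAction'' m).clm_comp continuous_const)

theorem hasFDerivAt_interior (e : Config d × Config d) (u : PathSpace d m) :
    HasFDerivAt (fun u => S.pathAction m (e, u))
      ((S.pathAction' m (e, u)).comp (.inr ℝ (Config d × Config d) (PathSpace d m))) u :=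
  hasFDerivAt_slice (S.hasFDerivAt_pathAction m (e, u))

theorem hasFDerivAt_interior' (e : Config d × Config d) (u : PathSpace d m) :
    HasFDerivAt (fun u => (S.pathAction' m (e, u)).comp
        (.inr ℝ (Config d × Config d) (PathSpace d m))) (S.interiorHessian m (e, u)) u := by
  have h1 := hasFDerivAt_slice (G := StrongDual ℝ (FullPath d m)) (f := S.pathAction' m)
    (S.hasFDerivAt_pathAction' m (e, u))
  exact ((ContinuousLinearMap.compL ℝ (PathSpace d m) (FullPath d m) ℝ).flip
    (.inr ℝ (Config d × Config d) (PathSpace d m))).hasFDerivAt.comp u h1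

theorem interiorHessian_symm (v : FullPath d m) (ξ ζ : PathSpace d m) :
    S.interiorHessian m v ξ ζ = S.interiorHessian m v ζ ξ := by
  simp only [interiorHessian_apply, pathAction''_apply]
  exact Finset.sum_congr rfl fun k _ => S.fderiv_fderiv_symm _ _ _

/-- The action controls every step through quadratic growth, and the steps control the distance from
the first point. The last point is left free, as `diagonal_critical_of_max` needs compactness with
moving ends. -/
theorem isBounded_sublevel (R C : ℝ) :
    IsBounded {v : FullPath d m | ‖v.1.1‖ ≤ R ∧ S.pathAction m v ≤ C} := by
  obtain ⟨a, B, ha, hB⟩ := S.exists_quadratic_growth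
  let D := √((C + (m + 1 : ℕ) * B) / a)
  have hnode : ∀ v ∈ {v : FullPath d m | ‖v.1.1‖ ≤ R ∧ S.pathAction m v ≤ C}, ∀ k ≤ m + 1,
      ‖node m k v‖ ≤ R + (m + 1) * D := by
    rintro v ⟨hv1, hv2⟩ k hk
    have h1 : ∀ k < m + 1, ‖node m k v - node m (k + 1) v‖ ≤ D := by
      intro k hk
      have := sq_step_le ha hB (w := fun k => node m k v) hk
      refine Real.le_sqrt_of_sq_le ?_
      rw [le_div_iff₀ ha]
      have h2 : action S.toFun (m + 1) (fun k => node m k v) ≤ C := hv2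
      linarith
    have h2 := norm_le_of_steps (w := fun k => node m k v) h1 hk
    have h3 : (k : ℝ) * D ≤ (m + 1) * D :=
      mul_le_mul_of_nonneg_right (by exact_mod_cast hk) (Real.sqrt_nonneg _)
    have h4 : node m 0 v = v.1.1 := node_zero m v
    simp only [h4] at h2
    linarith
  refine (isBounded_iff_forall_norm_le).2
    ⟨max (R + (m + 1) * D) (√(m * (R + (m + 1) * D) ^ 2)), fun v hv => ?_⟩
  have h := hnode v hv
  refine max_le (max_le ?_ ?_ |>.trans (le_max_left _ _)) (le_trans ?_ (le_max_right _ _))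
  · simpa [node_zero] using h 0 (by omega)
  · simpa [node_last] using h (m + 1) le_rfl
  · refine Real.le_sqrt_of_sq_le ?_
    have h5 : ‖v.2‖ ^ 2 = ∑ i, ‖PathSpace.equiv d m v.2 i‖ ^ 2 :=
      PiLp.norm_sq_eq_of_L2 (fun _ : Fin m => Config d) v.2
    rw [h5]
    calc ∑ i, ‖PathSpace.equiv d m v.2 i‖ ^ 2 ≤ ∑ _i : Fin m, (R + (m + 1) * D) ^ 2 := by
          refine Finset.sum_le_sum fun i _ => ?_
          have := h (i + 1) (by omega)
          rw [node_succ] at this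
          gcongr
      _ = m * (R + (m + 1) * D) ^ 2 := by simp

theorem isBounded_interior_sublevel (e : Config d × Config d) (C : ℝ) :
    IsBounded {u : PathSpace d m | S.pathAction m (e, u) ≤ C} := by
  obtain ⟨K, hK⟩ := (isBounded_iff_forall_norm_le).1 (S.isBounded_sublevel m ‖e.1‖ C)
  exact (isBounded_iff_forall_norm_le).2
    ⟨K, fun u hu => (le_max_right _ _).trans (hK (e, u) ⟨le_rfl, hu⟩)⟩

theorem exists_minimizer (e : Config d × Config d) :
    ∃ u : PathSpace d m, ∀ u', S.pathAction m (e, u) ≤ S.pathAction m (e, u') := by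
  have hc : Continuous fun u : PathSpace d m => S.pathAction m (e, u) :=
    (S.continuous_pathAction m).comp (by fun_prop)
  refine hc.exists_forall_le (tendsto_atTop.2 fun C => ?_)
  rw [← Metric.cobounded_eq_cocompact]
  have := isBounded_def.1 (S.isBounded_interior_sublevel m e C)
  filter_upwards [this] with u hu
  exact (not_le.1 (show ¬ S.pathAction m (e, u) ≤ C from hu)).le

theorem interior_critical_of_min {e : Config d × Config d} {u : PathSpace d m}
    (h : ∀ u', S.pathAction m (e, u) ≤ S.pathAction m (e, u')) :
    (S.pathAction' m (e, u)).comp (.inr ℝ (Config d × Config d) (PathSpace d m)) = 0 :=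
  IsLocalMin.hasFDerivAt_eq_zero (Eventually.of_forall h) (S.hasFDerivAt_interior m e u)

/-- Summation by parts, with no boundary terms as the end points are not varied, gives the discrete
Euler–Lagrange equations. -/
theorem critical_iff (v : FullPath d m) :
    (S.pathAction' m v).comp (.inr ℝ (Config d × Config d) (PathSpace d m)) = 0 ↔
      ∀ k < m, partialSnd S.toFun (node m k v) (node m (k + 1) v) +
          partialFst S.toFun (node m (k + 1) v) (node m (k + 2) v) = 0 := by
  have key : ∀ ζ : PathSpace d m,
      (S.pathAction' m v).comp (.inr ℝ (Config d × Config d) (PathSpace d m)) ζ =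
      ∑ k ∈ Finset.range m, (partialSnd S.toFun (node m k v) (node m (k + 1) v) +
          partialFst S.toFun (node m (k + 1) v) (node m (k + 2) v))
            (node m (k + 1) ((0 : Config d × Config d), ζ)) := by
    intro ζ
    rw [ContinuousLinearMap.comp_apply, ContinuousLinearMap.inr_apply, pathAction'_apply,
      node_zero m (0, ζ), node_last m (0, ζ)]
    simp
  constructor
  · intro h k hk
    exact eq_zero_of_sum_eq_zero m (R := fun k =>
      partialSnd S.toFun (node m k v) (node m (k + 1) v) +
          partialFst S.toFun (node m (k + 1) v) (node m (k + 2) v))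
      (fun ζ => by rw [← key, h]; rfl) hk
  · intro h
    ext1 ζ
    rw [key, Finset.sum_eq_zero fun k hk => by rw [h k (Finset.mem_range.1 hk)]; rfl]
    rfl

/-- Critical sequences are parts of orbits. -/
theorem ofSeq_orbit_of_critical {v : FullPath d m}
    (h : (S.pathAction' m v).comp (.inr ℝ (Config d × Config d) (PathSpace d m)) = 0) :
    ofSeq m (S.orbit (v.1.1, -partialFst S.toFun v.1.1 (node m 1 v))) = v := by
  have h1 := (S.critical_iff m v).1 h
  conv_rhs => rw [← ofSeq_node m v]
  refine ofSeq_congr m fun k hk => ?_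
  have := S.orbit_eq_of_critical (n := m + 1) (w := fun k => node m k v)
    (fun k hk => h1 k (by omega)) hk
  simpa only [node_zero] using this

theorem critical_ofSeq_orbit (q : Phase d) :
    (S.pathAction' m (ofSeq m (S.orbit q))).comp
      (.inr ℝ (Config d × Config d) (PathSpace d m)) = 0 := by
  rw [critical_iff]
  intro k hk
  rw [node_ofSeq m _ (by omega), node_ofSeq m _ (by omega), node_ofSeq m _ (by omega)]
  exact S.orbit_critical q k

variable {S}

namespace WithoutConjugatePoints

/-- A kernel vector, extended by 0 at both ends, solves the linearized Euler–Lagrange equations: it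
is a Jacobi field vanishing at times `0` and `m + 1`. -/
theorem interiorHessian_nondegenerate (hS : S.WithoutConjugatePoints) (q : Phase d)
    {ξ : PathSpace d m} (h : ∀ ζ, S.interiorHessian m (ofSeq m (S.orbit q)) ξ ζ = 0) :
    ξ = 0 := by
  let x := S.orbit q
  let H : ℕ → StrongDual ℝ (Config d × Config d) := fun k =>
    fderiv ℝ (fderiv ℝ S.toFun) (x k, x (k + 1)) (edge m k (0, ξ))
  have hsum : ∀ ζ : PathSpace d m, ∑ k ∈ Finset.range m,
      ((H k).comp (.inr ℝ (Config d) (Config d)) +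
        (H (k + 1)).comp (.inl ℝ (Config d) (Config d)))
          (node m (k + 1) ((0 : Config d × Config d), ζ)) = 0 := by
    intro ζ
    have h1 := h ζ
    rw [interiorHessian_apply, pathAction''_apply] at h1
    have h2 := sum_edges m (fun k => (H k).comp (.inl ℝ (Config d) (Config d)))
      (fun k => (H k).comp (.inr ℝ (Config d) (Config d)))
      (fun k => node m k ((0 : Config d × Config d), ζ))
    rw [node_zero, node_last] at h2
    simp only [Prod.fst_zero, Prod.snd_zero, map_zero, zero_add] at h2
    rw [← h2, ← h1]
    refine Finset.sum_congr rfl fun k hk => ?_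
    have hk' := Finset.mem_range.1 hk
    have h3 : edge m k (ofSeq m (S.orbit q)) = (x k, x (k + 1)) :=
      Prod.ext (node_ofSeq m _ (by omega)) (node_ofSeq m _ (by omega))
    rw [h3]
    simp only [ContinuousLinearMap.comp_apply, ContinuousLinearMap.inl_apply,
      ContinuousLinearMap.inr_apply, ← map_add]
    simp [edge, H]
  have hjac := fun k (hk : k < m) => eq_zero_of_sum_eq_zero m (R := fun k =>
    (H k).comp (.inr ℝ (Config d) (Config d)) +
        (H (k + 1)).comp (.inl ℝ (Config d) (Config d))) hsum hk
  have h0 := fun k (hk : k ≤ m + 1) => hS.jacobi_eq_zero q (n := m + 1) (by omega)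
    (ξ := fun k => node m k ((0 : Config d × Config d), ξ)) (by rw [node_zero]; rfl)
    (by rw [node_last]; rfl) (fun k hk => hjac k (by omega)) hk
  refine (PathSpace.equiv d m).map_eq_zero_iff.1 (funext fun i => ?_)
  have := h0 (i + 1) (by omega)
  rw [node_succ] at this
  exact this

/-- Without conjugate points the second differential of the action with fixed end points is
positive definite along all orbits. -/
theorem interiorHessian_pos (hS : S.WithoutConjugatePoints) (q : Phase d)
    {ξ : PathSpace d m} (hξ : ξ ≠ 0) : 0 < S.interiorHessian m (ofSeq m (S.orbit q)) ξ ξ := by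
  let B : Phase d → PathSpace d m →L[ℝ] StrongDual ℝ (PathSpace d m) := fun q =>
    S.interiorHessian m (ofSeq m (S.orbit q))
  have hcont : Continuous fun q => ofSeq m (S.orbit q) := by
    refine ((S.continuous_orbit 0).prodMk (S.continuous_orbit (m + 1))).prodMk ?_
    exact (PathSpace.equiv d m).symm.continuous.comp (continuous_pi fun i => S.continuous_orbit _)
  have hB : Continuous B := (S.continuous_interiorHessian m).comp hcont
  have hpos : ∀ q, (∀ ξ, 0 ≤ B q ξ ξ) → ∀ ξ, ξ ≠ 0 → 0 < B q ξ ξ := fun q h ξ hξ =>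
    pos_of_nonneg_of_nondegenerate (B q) (S.interiorHessian_symm m _) h
      (fun ξ hξ => hS.interiorHessian_nondegenerate m q hξ) hξ
  -- One orbit segment with semidefinite Hessian starts the connectedness argument over phase space;
  -- any minimizer provides it.
  obtain ⟨u, hu⟩ := S.exists_minimizer m (0, 0)
  have h1 := S.ofSeq_orbit_of_critical m (S.interior_critical_of_min m hu)
  refine pos_of_connected hB hpos
    (q₀ := (0, -partialFst S.toFun 0 (node m 1 ((0, 0), u)))) (fun ξ => ?_) q hξ
  simp only [B]
  rw [h1]
  exact second_deriv_nonneg_of_min (S.hasFDerivAt_interior m (0, 0))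
    (S.hasFDerivAt_interior' m (0, 0)) hu ξ

/-- Without conjugate points there is only one critical sequence with given end points. -/
theorem eq_of_critical (hS : S.WithoutConjugatePoints) {e : Config d × Config d}
    {u u' : PathSpace d m}
    (hu : (S.pathAction' m (e, u)).comp (.inr ℝ (Config d × Config d) (PathSpace d m)) = 0)
    (hu' : (S.pathAction' m (e, u')).comp (.inr ℝ (Config d × Config d) (PathSpace d m)) = 0) :
    u = u' := by
  refine TwistMap.eq_of_critical (S.hasFDerivAt_interior m e) (S.hasFDerivAt_interior' m e)
    ((S.continuous_interiorHessian m).comp (by fun_prop))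
    (S.isBounded_interior_sublevel m e) (fun u hu ξ hξ => ?_) hu hu'
  have := hS.interiorHessian_pos m (e.1, -partialFst S.toFun e.1 (node m 1 (e, u))) hξ
  rwa [S.ofSeq_orbit_of_critical m hu] at this

/-- Without conjugate points orbits minimize the action. -/
theorem action_orbit_le (hS : S.WithoutConjugatePoints) (q : Phase d) {n : ℕ}
    {w : ℕ → Config d} (h0 : w 0 = S.orbit q 0) (hn : w n = S.orbit q n) :
    action S.toFun n (S.orbit q) ≤ action S.toFun n w := by
  rcases n with _ | m
  · simp [action]
  obtain ⟨u, hu⟩ := S.exists_minimizer m (S.orbit q 0, S.orbit q (m + 1))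
  -- A minimizer exists and is critical, hence is the orbit segment itself.
  have h1 := hS.eq_of_critical m (S.critical_ofSeq_orbit m q) (S.interior_critical_of_min m hu)
  have h2 : ofSeq m (S.orbit q) = ((S.orbit q 0, S.orbit q (m + 1)), u) := Prod.ext rfl h1
  have h3 := hu (ofSeq m w).2
  have h4 : ((S.orbit q 0, S.orbit q (m + 1)), (ofSeq m w).2) = ofSeq m w :=
    Prod.ext (Prod.ext h0.symm hn.symm) rfl
  rwa [h4, ← h2, pathAction_ofSeq, pathAction_ofSeq] at h3

end WithoutConjugatePoints

end GeneratingFunction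
end TwistMap

/-! ### Minimal loops: their action does not depend on the base point. -/

namespace TwistMap
namespace GeneratingFunction

open Bornology Filter Topology

variable {d : ℕ} (S : GeneratingFunction d) (m : ℕ)

theorem hasPath_pathAction (v : FullPath d m) :
    HasPath S.toFun (m + 1) v.1.1 v.1.2 (S.pathAction m v) :=
  ⟨fun k => node m k v, node_zero m v, node_last m v, rfl⟩

theorem le_of_hasPath {x y : Config d} {u : PathSpace d m}
    (hu : ∀ u', S.pathAction m ((x, y), u) ≤ S.pathAction m ((x, y), u')) {a : ℝ}
    (h : HasPath S.toFun (m + 1) x y a) : S.pathAction m ((x, y), u) ≤ a := by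
  obtain ⟨w, rfl, rfl, rfl⟩ := h
  rw [← pathAction_ofSeq]
  exact hu _

/-- A sequence whose minimal action is maximal among its translates closes up: if the minimizers
are unique, the differential of the action vanishes in the diagonal directions. -/
theorem diagonal_critical_of_max {x y : Config d} {u : Config d × Config d → PathSpace d m}
    (hu : ∀ e u', S.pathAction m (e, u e) ≤ S.pathAction m (e, u'))
    (huniq : ∀ u', (∀ u'', S.pathAction m ((x, y), u') ≤ S.pathAction m ((x, y), u'')) →
      u' = u (x, y))
    (hmax : ∀ a : Config d, S.pathAction m ((x + a, y + a), u (x + a, y + a)) ≤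
      S.pathAction m ((x, y), u (x, y))) (a : Config d) :
    S.pathAction' m ((x, y), u (x, y)) ((a, a), 0) = 0 := by
  -- One inequality suffices, because it can be applied to `-a` too.
  have hle : ∀ a : Config d, S.pathAction' m ((x, y), u (x, y)) ((a, a), 0) ≤ 0 := by
    intro a
    let t : ℕ → ℝ := fun j => 1 / ((j : ℝ) + 1)
    have ht0 : ∀ j, 0 < t j := fun j => Nat.one_div_pos_of_nat
    have ht1 : ∀ j, t j ≤ 1 := fun j => by
      rw [div_le_one (by positivity)]; linarith [Nat.cast_nonneg (α := ℝ) j]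
    have htl : Tendsto t atTop (𝓝 0) := tendsto_one_div_add_atTop_nhds_zero_nat
    -- The minimal action need not be differentiable. Freezing the minimizer at `(x, y)` would only
    -- bound the moved action from above, so the minimizers of the moved ends are used; they
    -- subconverge to a minimizer at `(x, y)`, hence to the unique one.
    let U : ℕ → PathSpace d m := fun j => u (x + t j • a, y + t j • a)
    have hbd := S.isBounded_sublevel m (‖x‖ + ‖a‖) (S.pathAction m ((x, y), u (x, y)))
    have hU : ∀ j, U j ∈ Prod.snd '' {v : FullPath d m | ‖v.1.1‖ ≤ ‖x‖ + ‖a‖ ∧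
        S.pathAction m v ≤ S.pathAction m ((x, y), u (x, y))} := fun j => by
      refine ⟨((x + t j • a, y + t j • a), U j), ⟨?_, hmax _⟩, rfl⟩
      refine (norm_add_le _ _).trans ?_
      rw [norm_smul, Real.norm_eq_abs, abs_of_pos (ht0 j)]
      have := mul_le_mul_of_nonneg_right (ht1 j) (norm_nonneg a)
      linarith
    obtain ⟨ū, -, φ, hφ, hlim⟩ := tendsto_subseq_of_bounded hbd.image_snd hU
    have htφ : Tendsto (fun j => t (φ j)) atTop (𝓝 0) := htl.comp hφ.tendsto_atTop
    have hline : ∀ z : Config d, Tendsto (fun j => z + t (φ j) • a) atTop (𝓝 z) := fun z => by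
      simpa using (htφ.smul_const a).const_add z
    have hends : Tendsto (fun j => (((x + t (φ j) • a, y + t (φ j) • a), U (φ j)) : FullPath d m))
        atTop (𝓝 ((x, y), ū)) := ((hline x).prodMk_nhds (hline y)).prodMk_nhds hlim
    have hū : ū = u (x, y) := huniq ū fun u' => by
      refine (le_of_tendsto (((S.continuous_pathAction m).tendsto _).comp hends)
        (Eventually.of_forall fun j => hmax _)).trans (hu _ _)
    rw [hū] at hlim
    -- With interior `U (φ j)` kept, the action at the moved ends is at most the maximum, which is
    -- at most the action at the original ends.
    have hmv : ∀ j, ∃ s ∈ Set.Ioo (0 : ℝ) 1, S.pathAction' m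
        ((x, y) + (s * t (φ j)) • (a, a), U (φ j)) ((a, a), 0) ≤ 0 := by
      intro j
      obtain ⟨s, hs, h⟩ := exists_segment_eq (S.hasFDerivAt_pathAction m) ((x, y), U (φ j))
        ((x + t (φ j) • a, y + t (φ j) • a), U (φ j))
      refine ⟨s, hs, ?_⟩
      have e1 : (((x + t (φ j) • a, y + t (φ j) • a), U (φ j)) : FullPath d m) -
          ((x, y), U (φ j)) = t (φ j) • ((a, a), 0) := by simp
      have e2 : (((x, y), U (φ j)) : FullPath d m) + s • t (φ j) • ((a, a), 0) =
          ((x, y) + (s * t (φ j)) • (a, a), U (φ j)) := by simp [smul_smul]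
      rw [e1, e2, map_smul, smul_eq_mul] at h
      have h1 : S.pathAction m ((x + t (φ j) • a, y + t (φ j) • a), U (φ j)) ≤
          S.pathAction m ((x, y), U (φ j)) := (hmax _).trans (hu _ _)
      by_contra! hc
      have := mul_pos (ht0 (φ j)) hc
      linarith
    choose s hs hmv using hmv
    have hst : Tendsto (fun j => s j * t (φ j)) atTop (𝓝 0) :=
      squeeze_zero (fun j => (mul_pos (hs j).1 (ht0 _)).le)
        (fun j => mul_le_of_le_one_left (ht0 _).le (hs j).2.le) htφ
    have hpt : Tendsto (fun j => (((x, y) + (s j * t (φ j)) • (a, a), U (φ j)) : FullPath d m))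
        atTop (𝓝 ((x, y), u (x, y))) := by
      refine Tendsto.prodMk_nhds ?_ hlim
      simpa using (hst.smul_const (a, a)).const_add (x, y)
    have hc : Continuous fun v => S.pathAction' m v ((a, a), 0) :=
      (S.continuous_pathAction' m).clm_apply continuous_const
    exact le_of_tendsto ((hc.tendsto _).comp hpt) (Eventually.of_forall hmv)
  refine le_antisymm (hle a) ?_
  have h1 := hle (-a)
  have h2 : (((-a, -a), 0) : FullPath d m) = -((a, a), 0) := by simp
  rw [h2, map_neg] at h1
  linarith

variable {S}

/-- Without conjugate points the minimal action of the sequences of `n` steps from `x` to `x + r`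
does not depend on `x`. -/
theorem WithoutConjugatePoints.exists_isLeast_loop (hS : S.WithoutConjugatePoints) {n : ℕ}
    (hn : 1 ≤ n) (r : Fin d → ℤ) :
    ∃ M, ∀ x, IsLeast {a | HasPath S.toFun n x (x + intVec r) a} M := by
  obtain ⟨m, rfl⟩ : ∃ m, n = m + 1 := ⟨n - 1, by omega⟩
  choose u hu using S.exists_minimizer m
  let F : Config d → ℝ := fun x =>
    S.pathAction m ((x, x + intVec r), u (x, x + intVec r))
  have hFpath : ∀ x, HasPath S.toFun (m + 1) x (x + intVec r) (F x) := fun x =>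
    S.hasPath_pathAction m ((x, x + intVec r), u (x, x + intVec r))
  have hFle : ∀ x a, HasPath S.toFun (m + 1) x (x + intVec r) a → F x ≤ a := fun x a h =>
    S.le_of_hasPath m (hu _) h
  have hFper : ∀ x s, F (x + intVec s) ≤ F x := fun x s => by
    refine hFle _ _ ?_
    have := (hFpath x).translate S.periodic s
    rwa [add_right_comm] at this
  -- A minimum over a continuous family is upper semicontinuous, which is enough for a maximum to
  -- exist.
  have husc : UpperSemicontinuous F := by
    intro x b hb
    have hc : Continuous fun y => S.pathAction m ((y, y + intVec r), u (x, x + intVec r)) :=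
      (S.continuous_pathAction m).comp (by fun_prop)
    filter_upwards [(hc.tendsto x).eventually_lt_const hb] with y hy
    exact (hu _ _).trans_lt hy
  obtain ⟨z, -, hz⟩ := (husc.upperSemicontinuousOn
    (Metric.closedBall (0 : Config d) √d)).exists_isMaxOn ⟨0, by simp⟩ (isCompact_closedBall _ _)
  have hmax : ∀ x, F x ≤ F z := fun x => by
    obtain ⟨s, hs⟩ := exists_intVec_near x
    have h1 : F (x - intVec s) ≤ F z := hz (by simpa using hs)
    have h2 := hFper (x - intVec s) s
    rw [sub_add_cancel] at h2
    exact h2.trans h1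
  let v : FullPath d m := ((z, z + intVec r), u (z, z + intVec r))
  have hcrit := S.interior_critical_of_min m (hu (z, z + intVec r))
  have hclose := S.diagonal_critical_of_max m (x := z) (y := z + intVec r) hu
    (fun u' hu' => hS.eq_of_critical m (S.interior_critical_of_min m hu') hcrit)
    (fun a => by
      have := hmax (z + a)
      simp only [F] at this
      rwa [add_right_comm] at this)
  have hcrit' := (S.critical_iff m v).1 hcrit
  -- The interior equations are known, so the diagonal derivative is just this boundary term; its
  -- vanishing says that final and initial momentum agree.
  have hclose' : partialFst S.toFun (node m 0 v) (node m 1 v) +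
      partialSnd S.toFun (node m m v) (node m (m + 1) v) = 0 := by
    ext1 a
    have h1 := hclose a
    rw [pathAction'_apply, Finset.sum_eq_zero fun k hk => by
      rw [hcrit' k (Finset.mem_range.1 hk)]; rfl] at h1
    rw [node_zero m ((a, a), 0), node_last m ((a, a), 0)] at h1
    simpa using h1
  let q : Phase d := (z, -partialFst S.toFun z (node m 1 v))
  have horb : ∀ k ≤ m + 1, S.orbit q k = node m k v := fun k hk => by
    have h1 := congrArg (node m k) (S.ofSeq_orbit_of_critical m hcrit)
    rwa [node_ofSeq m _ hk] at h1
  have hper : S.twistMap^[m + 1] q = q + (intVec r, 0) := by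
    refine Prod.ext ?_ ?_
    · have := horb (m + 1) le_rfl
      rw [node_last] at this
      exact this
    · rw [(S.iterate_snd_eq q m).2, horb m (by omega), horb (m + 1) le_rfl,
        eq_neg_of_add_eq_zero_right hclose', node_zero]
      exact (add_zero _).symm
  have hsum : ∀ j : ℕ, S.orbit q (j * (m + 1)) = z + intVec (j • r) ∧
      action S.toFun (j * (m + 1)) (S.orbit q) = j * F z := by
    intro j
    induction j with
    | zero => exact ⟨by simp [orbit_zero, q], by simp [action]⟩
    | succ j ih =>
      constructor
      · rw [add_mul, one_mul, S.orbit_add_period hper, ih.1, succ_nsmul, intVec_add, add_assoc]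
      · rw [add_mul, one_mul, add_comm, action_add]
        have h1 : action S.toFun (m + 1) (S.orbit q) = F z := action_congr horb
        have h2 : (action S.toFun (j * (m + 1)) fun k => S.orbit q (m + 1 + k)) =
            action S.toFun (j * (m + 1)) (S.orbit q) := by
          refine Finset.sum_congr rfl fun k _ => ?_
          have h3 := S.orbit_add_period hper k
          have h4 := S.orbit_add_period hper (k + 1)
          rw [add_comm] at h3 h4
          change S.toFun (S.orbit q (m + 1 + k), S.orbit q (m + 1 + (k + 1))) = _
          rw [h3, h4, S.periodic]
        rw [h1, h2, ih.2]
        push_cast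
        ring
  have hmin : ∀ (j : ℕ) a, HasPath S.toFun (j * (m + 1)) z (z + intVec (j • r)) a →
      j * F z ≤ a := by
    rintro j a ⟨w, hw0, hwn, rfl⟩
    rw [← (hsum j).2]
    exact hS.action_orbit_le q hw0 (hwn.trans (hsum j).1.symm)
  refine ⟨F z, fun x => ?_⟩
  have hx : F x = F z := by
    refine le_antisymm (hmax x) ?_
    obtain ⟨c₁, hc₁⟩ : ∃ c, HasPath S.toFun (m + 1) z (x + intVec r) c :=
      ⟨_, S.hasPath_pathAction m ((z, x + intVec r), 0)⟩
    obtain ⟨c₂, hc₂⟩ : ∃ c, HasPath S.toFun (m + 1) x (z + intVec r) c :=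
      ⟨_, S.hasPath_pathAction m ((x, z + intVec r), 0)⟩
    -- Compare `j + 2` turns of the periodic orbit with a detour of equally many steps: one turn to
    -- go from `z` to `x`, `j` turns around the loop at `x`, one turn back. The fixed costs `c₁`,
    -- `c₂` become negligible as `j` grows.
    have key : ∀ j : ℕ, (j + 2) * F z ≤ c₁ + j * F x + c₂ := by
      intro j
      have h1 := ((hFpath x).iterate S.periodic j).translate S.periodic r
      have h2 := hc₂.translate S.periodic (r + j • r)
      have e1 : x + intVec (j • r) + intVec r = x + intVec (r + j • r) := by
        rw [intVec_add]; abel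
      have e2 : z + intVec r + intVec (r + j • r) = z + intVec ((j + 2) • r) := by
        rw [add_nsmul, two_nsmul]; simp only [intVec_add]; abel
      rw [e1] at h1
      rw [e2] at h2
      have h3 := (hc₁.trans h1).trans h2
      rw [show m + 1 + j * (m + 1) + (m + 1) = (j + 2) * (m + 1) by ring] at h3
      have := hmin (j + 2) _ h3
      push_cast at this
      exact this
    by_contra! hc
    obtain ⟨j, hj⟩ := exists_nat_gt ((c₁ + c₂ - 2 * F z) / (F z - F x))
    rw [div_lt_iff₀ (by linarith)] at hj
    have := key j
    nlinarith
  rw [← hx]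
  exact ⟨hFpath x, fun a ha => hFle x a ha⟩

end GeneratingFunction
end TwistMap

/-! ### Periodic costs: holonomic value, almost calibrated loops, Mañé potential. -/

namespace TwistMap

open Filter Topology

/-- Costs that are `C^1`, invariant under the diagonal action of the lattice, and of quadratic
growth away from the diagonal. -/
structure IsPeriodicCost {d : ℕ} (L : Config d × Config d → ℝ) : Prop where
  contDiff : ContDiff ℝ 1 L
  periodic : ∀ (r : Fin d → ℤ) (x y : Config d), L (x + intVec r, y + intVec r) = L (x, y)
  growth : ∃ a B : ℝ, 0 < a ∧ ∀ x y, a * ‖x - y‖ ^ 2 - B ≤ L (x, y)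

section Normalized

variable {d : ℕ} {L : Config d × Config d → ℝ}

theorem normalizedAction_add (n m : ℕ) (w : ℕ → Config d) :
    normalizedAction L (n + m) w =
      normalizedAction L n w + normalizedAction L m fun k => w (n + k) := by
  simp only [normalizedAction, action_add]
  push_cast
  ring

theorem normalizedAction_one (w : ℕ → Config d) :
    normalizedAction L 1 w = L (w 0, w 1) - minimizingHolonomicValue L := by
  simp [normalizedAction, action]

theorem holonomicInf_le_of_frequently {w : ℕ → Config d} {c : ℝ}
    (h : ∃ᶠ n : ℕ in atTop, action L n w / n ≤ c) : holonomicInf L ≤ (c : EReal) :=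
  (iInf_le _ w).trans (liminf_le_of_frequently_le
    (h.mono fun _ hn => EReal.coe_le_coe_iff.2 hn))

theorem mem_connectingActions_iff {x y : Config d} {a : ℝ} :
    a ∈ connectingActions L x y ↔ ∃ (n : ℕ) (r : Fin d → ℤ) (b : ℝ), 1 ≤ n ∧
      HasPath L n x (y + intVec r) b ∧ a = b - n * minimizingHolonomicValue L := by
  constructor
  · rintro ⟨n, w, hn, h0, ⟨r, hr⟩, rfl⟩
    exact ⟨n, r, _, hn, ⟨w, h0, by rw [hr, add_sub_cancel], rfl⟩, rfl⟩
  · rintro ⟨n, r, b, hn, ⟨w, h0, hw, rfl⟩, rfl⟩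
    exact ⟨n, w, hn, h0, ⟨r, by rw [hw, add_sub_cancel_left]⟩, rfl⟩

end Normalized

namespace IsPeriodicCost

variable {d : ℕ} {L : Config d × Config d → ℝ}

theorem exists_lower_bound (hL : IsPeriodicCost L) :
    ∃ B : ℝ, 0 ≤ B ∧ ∀ (n : ℕ) (w : ℕ → Config d), -(n * B) ≤ action L n w := by
  obtain ⟨a, B, ha, hB⟩ := hL.growth
  refine ⟨|B|, abs_nonneg B, fun n w => ?_⟩
  have : ∑ _k ∈ Finset.range n, -|B| ≤ action L n w := by
    refine Finset.sum_le_sum fun k _ => ?_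
    have h1 := hB (w k) (w (k + 1))
    have h2 : 0 ≤ a * ‖w k - w (k + 1)‖ ^ 2 := by positivity
    have h3 := le_abs_self B
    linarith
  simpa using this

/-- The minimizing holonomic value is finite. -/
theorem holonomicInf_eq (hL : IsPeriodicCost L) :
    holonomicInf L = ((minimizingHolonomicValue L : ℝ) : EReal) := by
  obtain ⟨B, -, hB⟩ := hL.exists_lower_bound
  have h1 : ((-B : ℝ) : EReal) ≤ holonomicInf L := by
    refine le_iInf fun w => le_liminf_of_le (h := ?_)
    filter_upwards [eventually_ge_atTop 1] with n hn
    rw [EReal.coe_le_coe_iff, le_div_iff₀ (by exact_mod_cast hn)]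
    have := hB n w
    linarith
  have h2 : holonomicInf L ≤ ((L (0, 0) : ℝ) : EReal) := by
    refine holonomicInf_le_of_frequently (w := fun _ => 0) (Eventually.frequently ?_)
    filter_upwards [eventually_ge_atTop 1] with n hn
    rw [div_le_iff₀ (by exact_mod_cast hn)]
    simp [action, mul_comm]
  exact (EReal.coe_toReal (ne_top_of_le_ne_top (EReal.coe_ne_top _) h2)
    (ne_bot_of_le_ne_bot (EReal.coe_ne_bot _) h1)).symm

/-- The average action of a closed sequence is at least the minimizing holonomic value. -/
theorem le_of_loop (hL : IsPeriodicCost L) {n : ℕ} (hn : 1 ≤ n) {x : Config d} {r : Fin d → ℤ}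
    {a : ℝ} (h : HasPath L n x (x + intVec r) a) : n * minimizingHolonomicValue L ≤ a := by
  obtain ⟨w, rfl, hwn, rfl⟩ := h
  -- The loop repeated forever, shifted by `r` at every turn; its average action after whole turns
  -- is that of one turn.
  let v : ℕ → Config d := fun k => w (k % n) + intVec ((k / n) • r)
  have hv : ∀ j, ∀ i ≤ n, v (j * n + i) = w i + intVec (j • r) := by
    intro j i hi
    rcases hi.eq_or_lt with rfl | hi
    · have h1 : (j * i + i) % i = 0 := by simp
      have h2 : (j * i + i) / i = j + 1 := by
        rw [← Nat.succ_mul, Nat.mul_div_cancel _ (by omega)]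
      simp only [v, h1, h2, hwn]
      rw [succ_nsmul', intVec_add, add_assoc]
    · have h1 : (j * n + i) % n = i := by
        rw [Nat.mul_add_mod', Nat.mod_eq_of_lt hi]
      have h2 : (j * n + i) / n = j := by
        rw [mul_comm, Nat.mul_add_div (by omega), Nat.div_eq_of_lt hi, add_zero]
      simp only [v, h1, h2]
  have hact : ∀ j : ℕ, action L (j * n) v = j * action L n w := by
    intro j
    induction j with
    | zero => simp [action]
    | succ j ih =>
      rw [add_mul, one_mul, action_add, ih]
      have : (action L n fun k => v (j * n + k)) = action L n w := by
        refine Finset.sum_congr rfl fun k hk => ?_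
        have hk' := Finset.mem_range.1 hk
        change L (v (j * n + k), v (j * n + (k + 1))) = _
        rw [hv j k hk'.le, hv j (k + 1) hk', hL.periodic]
      rw [this]
      push_cast
      ring
  have hn' : (0 : ℝ) < n := by exact_mod_cast hn
  have hfreq : ∃ᶠ N : ℕ in atTop, action L N v / N ≤ action L n w / n := by
    refine frequently_atTop.2 fun N => ⟨(N + 1) * n, ?_, ?_⟩
    · nlinarith
    · rw [hact]
      refine le_of_eq ?_
      push_cast
      field_simp
  have := holonomicInf_le_of_frequently hfreq
  rw [hL.holonomicInf_eq, EReal.coe_le_coe_iff, le_div_iff₀ hn'] at this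
  linarith

/-- There are arbitrarily long sequences with bounded normalized action. -/
theorem exists_normalizedAction_le (hL : IsPeriodicCost L) {n : ℕ} (hn : 1 ≤ n) :
    ∃ w, normalizedAction L n w ≤ 1 := by
  by_contra! hc
  obtain ⟨B, hB0, hB⟩ := hL.exists_lower_bound
  set c := minimizingHolonomicValue L with hcdef
  have hn' : (0 : ℝ) < n := by exact_mod_cast hn
  -- If every block of `n` steps exceeded its share by more than 1, averages would exceed `c` by
  -- about `1 / n` in the long run; some sequence stays below `c + 1 / (2 * n)` infinitely often.
  have hlt : holonomicInf L < ((c + 1 / (2 * n) : ℝ) : EReal) := by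
    rw [hL.holonomicInf_eq, EReal.coe_lt_coe_iff]
    have : (0 : ℝ) < 1 / (2 * n) := by positivity
    linarith
  obtain ⟨w, hw⟩ := iInf_lt_iff.1 hlt
  have hfreq := frequently_lt_of_liminf_lt (h := hw)
  have hblock : ∀ (j : ℕ) (w : ℕ → Config d), j * (n * c + 1) ≤ action L (j * n) w := by
    intro j
    induction j with
    | zero => intro w; simp [action]
    | succ j ih =>
      intro w
      rw [add_mul, one_mul, action_add]
      have h1 := ih w
      have h2 := hc fun k => w (j * n + k)
      simp only [normalizedAction] at h2
      push_cast
      linarith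
  -- After `J` blocks the surplus `j / 2` outweighs whatever an incomplete last block can save.
  obtain ⟨J, hJ⟩ := exists_nat_gt (2 * (n * |c| + 1 + n * B))
  obtain ⟨N, hN, hlt'⟩ := frequently_atTop.1 hfreq (J * n + 1)
  rw [EReal.coe_lt_coe_iff, div_lt_iff₀ (by exact_mod_cast (by omega : 0 < N))] at hlt'
  obtain ⟨j, i, hi, rfl⟩ : ∃ j i, i < n ∧ N = j * n + i :=
    ⟨N / n, N % n, Nat.mod_lt _ hn, by rw [mul_comm]; exact (Nat.div_add_mod N n).symm⟩
  have hjJ : J ≤ j := by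
    by_contra! hlt''
    have : (j + 1) * n ≤ J * n := Nat.mul_le_mul_right n hlt''
    rw [add_mul] at this
    omega
  rw [action_add] at hlt'
  have h1 := hblock j w
  have h2 := hB i fun k => w (j * n + k)
  have hi' : (i : ℝ) ≤ n := by exact_mod_cast hi.le
  have h3 : (i : ℝ) * B ≤ n * B := by gcongr
  have h4 : (i : ℝ) * c ≤ n * |c| := by
    calc (i : ℝ) * c ≤ i * |c| := by gcongr; exact le_abs_self c
      _ ≤ n * |c| := by gcongr
  have h5 : ((j * n + i : ℕ) : ℝ) * (1 / (2 * n)) = j / 2 + i / (2 * n) := by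
    push_cast
    field_simp
  have h6 : (i : ℝ) / (2 * n) ≤ 1 / 2 := by
    rw [div_le_div_iff₀ (by positivity) (by norm_num)]
    linarith
  have h7 : (J : ℝ) ≤ j := by exact_mod_cast hjJ
  have h8 : (c + 1 / (2 * n)) * ((j * n + i : ℕ) : ℝ) =
      c * (j * n) + c * i + ((j * n + i : ℕ) : ℝ) * (1 / (2 * n)) := by
    push_cast
    ring
  rw [h8, h5] at hlt'
  nlinarith

/-- The cost is uniformly continuous in the second variable along steps of bounded length. -/
theorem exists_modulus (hL : IsPeriodicCost L) (D : ℝ) {ε : ℝ} (hε : 0 < ε) :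
    ∃ η : ℝ, 0 < η ∧ ∀ x y y', ‖x - y‖ ≤ D → ‖y - y'‖ < η → |L (x, y) - L (x, y')| < ε := by
  let K : Set (Config d × Config d) := Metric.closedBall 0 √d ×ˢ Metric.closedBall 0 (√d + D + 1)
  have hK : IsCompact K := (isCompact_closedBall _ _).prod (isCompact_closedBall _ _)
  obtain ⟨δ, hδ, h⟩ := Metric.uniformContinuousOn_iff.1
    (hK.uniformContinuousOn_of_continuous hL.contDiff.continuous.continuousOn) ε hε
  refine ⟨min δ 1, lt_min hδ one_pos, fun x y y' hxy hyy' => ?_⟩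
  obtain ⟨r, hr⟩ := exists_intVec_near x
  have e : ∀ z, L (x, z) = L (x - intVec r, z - intVec r) := fun z => by
    rw [← hL.periodic r (x - intVec r), sub_add_cancel, sub_add_cancel]
  have h1 : ‖y - intVec r‖ ≤ √d + D := by
    have : y - intVec r = (x - intVec r) - (x - y) := by abel
    rw [this]
    exact (norm_sub_le _ _).trans (by linarith)
  have h2 : ‖y' - intVec r‖ ≤ √d + D + 1 := by
    have : y' - intVec r = (y - intVec r) - (y - y') := by abel
    rw [this]
    have := hyy'.trans_le (min_le_right _ _)
    exact (norm_sub_le _ _).trans (by linarith)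
  have := h (x - intVec r, y - intVec r) ⟨by simpa using hr, by simp; linarith⟩
    (x - intVec r, y' - intVec r) ⟨by simpa using hr, by simpa using h2⟩ (by
      rw [Prod.dist_eq]
      simpa [dist_eq_norm, hδ] using hyy'.trans_le (min_le_left _ _))
  rw [e y, e y']
  simpa [Real.dist_eq] using this

theorem exists_bound_near (hL : IsPeriodicCost L) (D : ℝ) :
    ∃ K, ∀ x y, ‖x - y‖ ≤ D → L (x, y) ≤ K := by
  obtain ⟨K, hK⟩ := ((isCompact_closedBall (0 : Config d) √d).prod
    (isCompact_closedBall (0 : Config d) (√d + D))).exists_bound_of_continuousOn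
      hL.contDiff.continuous.continuousOn
  refine ⟨K, fun x y hxy => ?_⟩
  obtain ⟨r, hr⟩ := exists_intVec_near x
  have h1 : ‖y - intVec r‖ ≤ √d + D := by
    have : y - intVec r = (x - intVec r) - (x - y) := by abel
    rw [this]
    exact (norm_sub_le _ _).trans (by linarith)
  have := hK (x - intVec r, y - intVec r) ⟨by simpa using hr, by simpa using h1⟩
  rw [← hL.periodic r, sub_add_cancel, sub_add_cancel] at this
  exact (le_abs_self _).trans this

/-- Normalized actions are bounded below, uniformly in the number of steps. -/
theorem exists_le_normalizedAction (hL : IsPeriodicCost L) :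
    ∃ C, ∀ (n : ℕ) (w : ℕ → Config d), -C ≤ normalizedAction L n w := by
  obtain ⟨K, hK⟩ := hL.exists_bound_near √d
  refine ⟨K - minimizingHolonomicValue L, fun n w => ?_⟩
  obtain ⟨r, hr⟩ := exists_intVec_near (w n - w 0)
  have h1 : HasPath L n (w 0) (w n) (action L n w) := ⟨w, rfl, rfl, rfl⟩
  -- One extra step of length at most `√d`, of cost at most `K`, closes the sequence modulo the
  -- lattice.
  have h2 := hL.le_of_loop (by omega) (h1.trans (HasPath.single (w n) (w 0 + intVec r)))
  have h3 := hK (w n) (w 0 + intVec r) (by rwa [← sub_sub])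
  simp only [normalizedAction]
  push_cast at h2
  linarith

/-- The steps of sequences with small normalized action are bounded. -/
theorem exists_step_bound (hL : IsPeriodicCost L) :
    ∃ D, ∀ (n : ℕ) (w : ℕ → Config d), normalizedAction L n w ≤ 1 →
      ∀ k < n, ‖w k - w (k + 1)‖ ≤ D := by
  obtain ⟨C, hC⟩ := hL.exists_le_normalizedAction
  obtain ⟨a, B, ha, hB⟩ := hL.growth
  refine ⟨√((1 + 2 * C + minimizingHolonomicValue L + B) / a), fun n w hw k hk => ?_⟩
  obtain ⟨j, rfl⟩ : ∃ j, n = k + 1 + j := ⟨n - (k + 1), by omega⟩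
  -- The parts before and after the step each contribute at least `-C`, which bounds the cost of the
  -- step uniformly in `n`.
  rw [normalizedAction_add, normalizedAction_add, normalizedAction_one] at hw
  have h1 := hC k w
  have h2 := hC j fun i => w (k + 1 + i)
  have h3 := hB (w k) (w (k + 1))
  refine Real.le_sqrt_of_sq_le ?_
  rw [le_div_iff₀ ha]
  simp only [add_zero] at hw
  linarith

/-- There are closed sequences with arbitrarily small normalized action. -/
theorem exists_loop_lt (hL : IsPeriodicCost L) {ε : ℝ} (hε : 0 < ε) :
    ∃ (n : ℕ) (x : Config d) (r : Fin d → ℤ) (a : ℝ), 1 ≤ n ∧ HasPath L n x (x + intVec r) a ∧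
      a - n * minimizingHolonomicValue L < ε := by
  by_contra! hc
  obtain ⟨C, hC⟩ := hL.exists_le_normalizedAction
  obtain ⟨D, hD⟩ := hL.exists_step_bound
  obtain ⟨η, hη, hmod⟩ := hL.exists_modulus D (half_pos hε)
  -- Finitely many cells of radius `η / 2` cover the torus, so two visits to one cell are `η`-close
  -- modulo the lattice.
  obtain ⟨t, -, htf, hcov⟩ := (isCompact_closedBall (0 : Config d) √d).finite_cover_balls
    (half_pos hη)
  have hcell : ∀ x : Config d, ∃ c ∈ htf.toFinset, ∃ r : Fin d → ℤ,
      ‖x - intVec r - c‖ < η / 2 := by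
    intro x
    obtain ⟨r, hr⟩ := exists_intVec_near x
    obtain ⟨c, hct, hcx⟩ := Set.mem_iUnion₂.1
      (hcov (show x - intVec r ∈ Metric.closedBall (0 : Config d) √d by simpa using hr))
    exact ⟨c, htf.mem_toFinset.2 hct, r, by simpa [dist_eq_norm] using hcx⟩
  choose cell hcell_mem shift hshift using hcell
  -- `K + 1` visits to one cell delimit `K` segments; at `ε / 2` each they exceed the bound 1 plus
  -- the `2 * C` that the two outer parts can save.
  obtain ⟨K, hK⟩ := exists_nat_gt ((1 + 2 * C) / (ε / 2))
  rw [div_lt_iff₀ (half_pos hε)] at hK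
  set n := htf.toFinset.card * K + 1 with hn
  obtain ⟨w, hw⟩ := hL.exists_normalizedAction_le (n := n) (by omega)
  obtain ⟨c, -, hcard⟩ := Finset.exists_lt_card_fiber_of_mul_lt_card_of_maps_to
    (s := Finset.range (n + 1)) (t := htf.toFinset) (f := fun k => cell (w k)) (n := K)
    (fun k _ => hcell_mem _) (by rw [Finset.card_range]; omega)
  -- Moving the last point of the segment closes it at a cost below `ε / 2`, while loops cost at
  -- least `ε` by assumption.
  have hseg : ∀ i j, i < j → j ≤ n → cell (w i) = c → cell (w j) = c →
      normalizedAction L i w + ε / 2 ≤ normalizedAction L j w := by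
    intro i j hij hjn hi hj
    obtain ⟨l, rfl⟩ : ∃ l, j = i + (l + 1) := ⟨j - i - 1, by omega⟩
    let r := shift (w (i + (l + 1))) - shift (w i)
    have hclose : ‖w (i + (l + 1)) - (w i + intVec r)‖ < η := by
      have h1 := hshift (w (i + (l + 1)))
      have h2 := hshift (w i)
      rw [hj] at h1
      rw [hi] at h2
      have e : w (i + (l + 1)) - (w i + intVec r) =
          (w (i + (l + 1)) - intVec (shift (w (i + (l + 1)))) - c) -
            (w i - intVec (shift (w i)) - c) := by
        simp only [r, sub_eq_add_neg, intVec_add, intVec_neg]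
        abel
      rw [e]
      exact (norm_sub_le _ _).trans_lt (by linarith)
    have h1 : HasPath L l (w i) (w (i + l)) (action L l fun k => w (i + k)) :=
      ⟨fun k => w (i + k), rfl, rfl, rfl⟩
    have h2 := hc (l + 1) _ r _ (by omega) (h1.trans (HasPath.single _ (w i + intVec r)))
    have h3 := hmod (w (i + l)) (w (i + (l + 1))) (w i + intVec r)
      (hD n w hw (i + l) (by omega)) hclose
    have h4 := (abs_lt.1 h3).1
    rw [normalizedAction_add, normalizedAction_add, normalizedAction_one]
    simp only [normalizedAction, add_zero]
    push_cast at h2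
    linarith
  have hcount : ∀ T : Finset ℕ, (∀ k ∈ T, k ≤ n ∧ cell (w k) = c) → ∀ M ∈ T, (∀ k ∈ T, k ≤ M) →
      -C + ((T.card : ℝ) - 1) * (ε / 2) ≤ normalizedAction L M w := by
    intro T
    induction T using Finset.induction_on_max with
    | empty => intro _ M hM; simp at hM
    | insert a T hlt ih =>
      intro hT M hM hmax
      have hMa : M = a := by
        rcases Finset.mem_insert.1 hM with h | h
        · exact h
        · have h1 := hlt M h
          have h2 := hmax a (Finset.mem_insert_self a T)
          omega
      subst hMa
      have hM' : M ∉ T := fun h => lt_irrefl _ (hlt M h)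
      rw [Finset.card_insert_of_notMem hM']
      rcases T.eq_empty_or_nonempty with rfl | hne
      · simpa using hC M w
      · have h1 := ih (fun k hk => hT k (Finset.mem_insert_of_mem hk)) (T.max' hne)
          (T.max'_mem hne) (fun k hk => T.le_max' k hk)
        have hm := hT _ (Finset.mem_insert_of_mem (T.max'_mem hne))
        have hMT := hT M (Finset.mem_insert_self M T)
        have h2 := hseg _ M (hlt _ (T.max'_mem hne)) hMT.1 hm.2 hMT.2
        push_cast
        linarith
  set T := (Finset.range (n + 1)).filter fun k => cell (w k) = c with hTdef
  have hT : ∀ k ∈ T, k ≤ n ∧ cell (w k) = c := fun k hk => by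
    have := Finset.mem_filter.1 hk
    exact ⟨by have := Finset.mem_range.1 this.1; omega, this.2⟩
  have hne : T.Nonempty := Finset.card_pos.1 (by omega)
  have h1 := hcount T hT (T.max' hne) (T.max'_mem hne) (fun k hk => T.le_max' k hk)
  obtain ⟨j, hj⟩ : ∃ j, n = T.max' hne + j :=
    ⟨n - T.max' hne, by have := (hT _ (T.max'_mem hne)).1; omega⟩
  rw [hj, normalizedAction_add] at hw
  have h2 := hC j fun k => w (T.max' hne + k)
  have h3 : (K : ℝ) + 1 ≤ T.card := by exact_mod_cast hcard
  have h4 : (K : ℝ) * (ε / 2) ≤ ((T.card : ℝ) - 1) * (ε / 2) := by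
    gcongr
    linarith
  linarith

/-! ### The Mañé potential -/

/-- The infimum that defines the Mañé potential is finite. -/
theorem isGLB_manePotential (hL : IsPeriodicCost L) (x y : Config d) :
    IsGLB (connectingActions L x y) (manePotential L x y) := by
  obtain ⟨C, hC⟩ := hL.exists_le_normalizedAction
  refine Real.isGLB_sInf ?_ ?_
  · exact ⟨_, mem_connectingActions_iff.2 ⟨1, 0, _, le_rfl, HasPath.single _ _, rfl⟩⟩
  · refine ⟨-C, ?_⟩
    rintro _ ⟨n, w, -, -, -, rfl⟩
    exact hC n w

theorem manePotential_le (hL : IsPeriodicCost L) {x y : Config d} {n : ℕ} (hn : 1 ≤ n)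
    {r : Fin d → ℤ} {a : ℝ} (h : HasPath L n x (y + intVec r) a) :
    manePotential L x y ≤ a - n * minimizingHolonomicValue L :=
  (hL.isGLB_manePotential x y).1 (mem_connectingActions_iff.2 ⟨n, r, a, hn, h, rfl⟩)

theorem manePotential_triangle (hL : IsPeriodicCost L) (x y z : Config d) :
    manePotential L x z ≤ manePotential L x y + manePotential L y z := by
  have h1 : ∀ a ∈ connectingActions L x y, ∀ b ∈ connectingActions L y z,
      manePotential L x z ≤ a + b := by
    intro a ha b hb
    obtain ⟨n, r, a', hn, hp, rfl⟩ := mem_connectingActions_iff.1 ha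
    obtain ⟨m, s, b', hm, hq, rfl⟩ := mem_connectingActions_iff.1 hb
    have h2 := hp.trans (hq.translate hL.periodic r)
    rw [add_assoc, ← intVec_add] at h2
    have := hL.manePotential_le (by omega) h2
    push_cast at this
    linarith
  have h2 : ∀ b ∈ connectingActions L y z, manePotential L x z - manePotential L x y ≤ b := by
    intro b hb
    have : manePotential L x z - b ≤ manePotential L x y :=
      (hL.isGLB_manePotential x y).2 fun a ha => by
        have := h1 a ha b hb
        linarith
    linarith
  have := (hL.isGLB_manePotential y z).2 h2
  linarith

theorem manePotential_self_nonneg (hL : IsPeriodicCost L) (x : Config d) :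
    0 ≤ manePotential L x x := by
  refine (hL.isGLB_manePotential x x).2 fun a ha => ?_
  obtain ⟨n, r, b, hn, hp, rfl⟩ := mem_connectingActions_iff.1 ha
  have := hL.le_of_loop hn hp
  linarith

end IsPeriodicCost
end TwistMap

/-! ### Consequences of homogeneous loops: Aubry set and antisymmetry. -/

namespace TwistMap

open Filter Topology

/-- The minimal action of the closed sequences in every homology class does not depend on the
base point. -/
def HasHomogeneousLoops {d : ℕ} (L : Config d × Config d → ℝ) : Prop :=
  ∀ (n : ℕ), 1 ≤ n → ∀ r : Fin d → ℤ, ∃ M, ∀ x, IsLeast {a | HasPath L n x (x + intVec r) a} M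

namespace IsPeriodicCost

variable {d : ℕ} {L : Config d × Config d → ℝ}

/-- Through every point there are minimal closed sequences with arbitrarily small normalized
action. -/
theorem exists_minimal_loop_lt (hL : IsPeriodicCost L) (hH : HasHomogeneousLoops L) (x : Config d)
    {ε : ℝ} (hε : 0 < ε) :
    ∃ (n : ℕ) (r : Fin d → ℤ) (w : ℕ → Config d), w 0 = x ∧ w (n + 2) = x + intVec r ∧
      normalizedAction L (n + 2) w < ε ∧
      ∀ y a, HasPath L (n + 2) y (y + intVec r) a → action L (n + 2) w ≤ a := by
  obtain ⟨n, y, r, a, hn, hp, ha⟩ := hL.exists_loop_lt (half_pos hε)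
  -- Turning twice guarantees at least two steps, so the first and last steps are distinct and the
  -- base point can be varied with both neighbours fixed.
  obtain ⟨m, hm⟩ : ∃ m, 2 * n = m + 2 := ⟨2 * n - 2, by omega⟩
  obtain ⟨M, hM⟩ := hH (m + 2) (by omega) (2 • r)
  obtain ⟨w, hw0, hwn, hwa⟩ := (hM x).1
  have h2 := hp.iterate hL.periodic 2
  rw [hm] at h2
  have h3 : M ≤ 2 * a := by exact_mod_cast (hM y).2 h2
  refine ⟨m, 2 • r, w, hw0, hwn, ?_, fun y a h => hwa.le.trans ((hM y).2 h)⟩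
  have h4 : ((m + 2 : ℕ) : ℝ) = 2 * n := by rw [← hm]; push_cast; ring
  rw [normalizedAction, hwa, h4]
  linarith

/-- Loops through `x` with normalized action tending to 0 have bounded first steps; a limit of their
second points serves as `y`. -/
theorem aubry_projects_onto (hL : IsPeriodicCost L) (hH : HasHomogeneousLoops L) :
    Prod.fst '' aubrySet L = Set.univ := by
  refine Set.eq_univ_of_forall fun x => ?_
  obtain ⟨D, hD⟩ := hL.exists_step_bound
  choose n r w hw0 hwn hlt _ using fun k : ℕ =>
    hL.exists_minimal_loop_lt hH x (Nat.one_div_pos_of_nat (α := ℝ) (n := k))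
  have hle : ∀ k : ℕ, 1 / ((k : ℝ) + 1) ≤ 1 := fun k => by
    rw [div_le_one (by positivity)]; linarith [Nat.cast_nonneg (α := ℝ) k]
  have hmem : ∀ k, w k 1 ∈ Metric.closedBall x D := fun k => by
    have := hD _ (w k) ((hlt k).le.trans (hle k)) 0 (by omega)
    rw [hw0] at this
    rw [Metric.mem_closedBall, dist_eq_norm, norm_sub_rev]
    exact this
  obtain ⟨y, -, φ, hφ, hlim⟩ := (isCompact_closedBall x D).tendsto_subseq hmem
  refine ⟨(x, y), fun ε hε => ?_, rfl⟩
  have h1 : ∀ᶠ k in atTop, 1 / (((φ k : ℕ) : ℝ) + 1) < ε :=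
    (tendsto_one_div_add_atTop_nhds_zero_nat.comp hφ.tendsto_atTop).eventually_lt_const hε
  have h2 : ∀ᶠ k in atTop, ‖y - w (φ k) 1‖ < ε := by
    filter_upwards [hlim.eventually (Metric.ball_mem_nhds y hε)] with k hk
    rw [← dist_eq_norm, dist_comm]
    exact hk
  obtain ⟨k, hk1, hk2⟩ := (h1.and h2).exists
  refine ⟨n (φ k) + 2, w (φ k), by omega, ⟨r (φ k), ?_⟩, ?_, hk2, (hlt _).trans hk1⟩
  · rw [hwn, hw0, add_sub_cancel_left]
  · rw [hw0]; simpa using hε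

theorem manePotential_self (hL : IsPeriodicCost L) (hH : HasHomogeneousLoops L) (x : Config d) :
    manePotential L x x = 0 := by
  refine le_antisymm (le_of_forall_pos_le_add fun ε hε => ?_) (hL.manePotential_self_nonneg x)
  obtain ⟨n, r, w, hw0, hwn, hlt, -⟩ := hL.exists_minimal_loop_lt hH x hε
  rw [zero_add]
  exact (hL.manePotential_le (by omega) ⟨w, hw0, hwn, rfl⟩).trans hlt.le

/-- The symmetrized Mañé potential is superlinear near the diagonal. -/
theorem symmetrized_manePotential_le (hL : IsPeriodicCost L) (hH : HasHomogeneousLoops L)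
    (x : Config d) {κ : ℝ} (hκ : 0 < κ) : ∀ᶠ y in 𝓝 x,
      manePotential L x y + manePotential L y x ≤ κ * ‖y - x‖ := by
  obtain ⟨D, hD⟩ := hL.exists_step_bound
  have hdiff : ∀ q, HasFDerivAt L (fderiv ℝ L q) q := fun q =>
    (hL.contDiff.differentiable (by norm_num) q).hasFDerivAt
  -- All loops used below have their neighbours of `x` within `D`, so the radius `ρ` depends neither
  -- on the loop nor on `ε`.
  have hK : IsCompact (Metric.closedBall (x, x) (max D 1)) := isCompact_closedBall _ _
  obtain ⟨ρ, hρ, huc⟩ := Metric.uniformContinuousOn_iff.1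
    (hK.uniformContinuousOn_of_continuous
      (f := fderiv ℝ L) (hL.contDiff.continuous_fderiv (by norm_num)).continuousOn)
        (κ / 2) (half_pos hκ)
  filter_upwards [Metric.ball_mem_nhds x (lt_min hρ one_pos)] with y hy
  rw [Metric.mem_ball, dist_eq_norm] at hy
  refine le_of_forall_pos_le_add fun ε hε => ?_
  obtain ⟨n, r, w, hw0, hwn, hlt, hmin⟩ := hL.exists_minimal_loop_lt hH x
    (lt_min (half_pos hε) one_pos)
  have hstep := hD _ w (hlt.le.trans (min_le_right _ _))
  set u := w 1 with hu
  set v := w (n + 1) - intVec r with hv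
  have hxu : ‖u - x‖ ≤ D := by
    have := hstep 0 (by omega)
    rwa [hw0, norm_sub_rev] at this
  have hxv : ‖v - x‖ ≤ D := by
    have := hstep (n + 1) (by omega)
    rw [hwn] at this
    rwa [hv, sub_sub, add_comm (intVec r)]
  have hLv : ∀ z, L (w (n + 1), z + intVec r) = L (v, z) := fun z => by
    rw [← hL.periodic r v, hv, sub_add_cancel]
  have hmid : HasPath L n u (w (n + 1)) (action L n fun k => w (1 + k)) :=
    ⟨fun k => w (1 + k), rfl, by rw [add_comm], rfl⟩
  have hsum : action L (n + 2) w =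
      L (x, u) + (action L n fun k => w (1 + k)) + L (v, x) := by
    rw [show n + 2 = 1 + n + 1 by ring, action_add, action_add, ← hLv x, ← hwn, hu, ← hw0]
    simp [action, add_comm, add_left_comm]
  -- Only the two ends change. Using `(x, y)` and `(y, x)` costs in total two loops plus `g y - g
  -- x`, with `g` below.
  have hpath : ∀ a b, HasPath L (n + 2) a (b + intVec r)
      (L (a, u) + (action L n fun k => w (1 + k)) + L (v, b)) := fun a b => by
    have := ((HasPath.single a u).trans hmid).trans (HasPath.single _ (b + intVec r))
    rw [hLv, show 1 + n + 1 = n + 2 by ring] at this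
    exact this
  have h1 := hL.manePotential_le (by omega) (hpath x y)
  have h2 := hL.manePotential_le (by omega) (hpath y x)
  let g : Config d → ℝ := fun z => L (v, z) + L (z, u)
  let g' : Config d → StrongDual ℝ (Config d) := fun z =>
    (fderiv ℝ L (v, z)).comp (.inr ℝ (Config d) (Config d)) +
      (fderiv ℝ L (z, u)).comp (.inl ℝ (Config d) (Config d))
  have hg : ∀ z, HasFDerivAt g (g' z) z := fun z =>
    ((hdiff (v, z)).comp z (hasFDerivAt_prodMk_right v z)).add
      ((hdiff (z, u)).comp z (hasFDerivAt_prodMk_left z u))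
  have hgmin : ∀ z, g x ≤ g z := fun z => by
    have := hmin z _ (hpath z z)
    rw [hsum] at this
    simp only [g]
    linarith
  -- The loop is minimal also among loops with another base point, so `x` minimizes `g` globally.
  have hg0 : g' x = 0 := IsLocalMin.hasFDerivAt_eq_zero (Eventually.of_forall hgmin) (hg x)
  obtain ⟨t, ht, hmv⟩ := exists_segment_eq hg x y
  set z := x + t • (y - x) with hz
  have hzx : ‖z - x‖ < min ρ 1 := by
    rw [hz, add_sub_cancel_left, norm_smul, Real.norm_eq_abs, abs_of_pos ht.1]
    exact (mul_le_of_le_one_left (norm_nonneg _) ht.2.le).trans_lt hy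
  have hz1 : ‖z - x‖ ≤ 1 := (hzx.trans_le (min_le_right _ _)).le
  have hzρ : ‖z - x‖ < ρ := hzx.trans_le (min_le_left _ _)
  have hmem : ∀ {a b : Config d}, ‖a - x‖ ≤ D → ‖b - x‖ ≤ 1 →
      (a, b) ∈ Metric.closedBall (x, x) (max D 1) := fun ha hb => by
    rw [Metric.mem_closedBall, dist_eq_norm]
    exact max_le (ha.trans (le_max_left _ _)) (hb.trans (le_max_right _ _))
  have hmem' : ∀ {a b : Config d}, ‖a - x‖ ≤ D → ‖b - x‖ ≤ 1 →
      (b, a) ∈ Metric.closedBall (x, x) (max D 1) := fun ha hb => by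
    rw [Metric.mem_closedBall, dist_eq_norm]
    exact max_le (hb.trans (le_max_right _ _)) (ha.trans (le_max_left _ _))
  have e1 : ‖fderiv ℝ L (v, z) - fderiv ℝ L (v, x)‖ < κ / 2 := by
    rw [← dist_eq_norm]
    refine huc _ ?_ _ ?_ ?_
    · exact hmem hxv hz1
    · exact hmem hxv (by simp)
    · simpa [Prod.dist_eq, dist_eq_norm, hρ] using hzρ
  have e2 : ‖fderiv ℝ L (z, u) - fderiv ℝ L (x, u)‖ < κ / 2 := by
    rw [← dist_eq_norm]
    refine huc _ ?_ _ ?_ ?_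
    · exact hmem' hxu hz1
    · exact hmem' hxu (by simp)
    · simpa [Prod.dist_eq, dist_eq_norm, hρ] using hzρ
  have e3 : g' z (y - x) = (fderiv ℝ L (v, z) - fderiv ℝ L (v, x)) (0, y - x) +
      (fderiv ℝ L (z, u) - fderiv ℝ L (x, u)) (y - x, 0) := by
    have e4 : g' z (y - x) = g' z (y - x) - g' x (y - x) := by rw [hg0]; simp
    rw [e4]
    simp only [g', add_apply, sub_apply, ContinuousLinearMap.comp_apply,
      ContinuousLinearMap.inl_apply, ContinuousLinearMap.inr_apply]
    ring
  have e5 := (fderiv ℝ L (v, z) - fderiv ℝ L (v, x)).le_of_opNorm_le e1.le (0, y - x)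
  have e6 := (fderiv ℝ L (z, u) - fderiv ℝ L (x, u)).le_of_opNorm_le e2.le (y - x, 0)
  have e7 : ‖((0, y - x) : Config d × Config d)‖ = ‖y - x‖ := by simp
  have e8 : ‖((y - x, 0) : Config d × Config d)‖ = ‖y - x‖ := by simp
  rw [Real.norm_eq_abs, e7] at e5
  rw [Real.norm_eq_abs, e8] at e6
  have e9 := (le_abs_self _).trans e5
  have e10 := (le_abs_self _).trans e6
  have e11 := hlt.trans_le (min_le_left _ _)
  rw [normalizedAction, hsum] at e11
  simp only [g] at hmv
  linarith

/-- The Mañé potential is antisymmetric. -/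
theorem manePotential_antisymm (hL : IsPeriodicCost L) (hH : HasHomogeneousLoops L)
    (x y : Config d) : manePotential L x y + manePotential L y x = 0 := by
  let δ : Config d → ℝ := fun y => manePotential L x y + manePotential L y x
  -- Four triangle inequalities bound the increment of `δ` between `y` and `z` by the symmetrized
  -- potential of `y` and `z`, which is `o(‖z - y‖)`.
  have hδ : ∀ y, HasFDerivAt δ (0 : StrongDual ℝ (Config d)) y := by
    intro y
    rw [hasFDerivAt_iff_isLittleO, Asymptotics.isLittleO_iff]
    intro κ hκ
    filter_upwards [hL.symmetrized_manePotential_le hH y hκ] with z hz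
    have h1 := hL.manePotential_triangle x y z
    have h2 := hL.manePotential_triangle z y x
    have h3 := hL.manePotential_triangle x z y
    have h4 := hL.manePotential_triangle y z x
    rw [zero_apply, sub_zero, Real.norm_eq_abs, abs_le]
    simp only [δ]
    constructor <;> linarith
  have h := is_const_of_fderiv_eq_zero (𝕜 := ℝ) (fun y => (hδ y).differentiableAt)
    (fun y => (hδ y).fderiv) y x
  simp only [δ, hL.manePotential_self hH, add_zero] at h
  exact h

/-- The Mañé potential is additive. -/
theorem manePotential_add (hL : IsPeriodicCost L) (hH : HasHomogeneousLoops L)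
    (x y z : Config d) :
    manePotential L x z = manePotential L x y + manePotential L y z := by
  have h1 := hL.manePotential_triangle x y z
  have h2 := hL.manePotential_triangle x z y
  have h3 := hL.manePotential_antisymm hH y z
  linarith

end IsPeriodicCost

/-! ### The shifted generating functions satisfy both hypotheses. -/

namespace GeneratingFunction

variable {d : ℕ} (S : GeneratingFunction d) (c : StrongDual ℝ (Config d))

theorem isPeriodicCost_shift : IsPeriodicCost (S.shift c) where
  contDiff := (S.contDiff.of_le (by norm_num)).add
    (c.contDiff.comp (contDiff_fst.sub contDiff_snd))
  periodic r x y := by simp [shift, S.periodic]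
  growth := by
    obtain ⟨a, B, ha, hB⟩ := S.exists_quadratic_growth
    refine ⟨a / 2, B + ‖c‖ ^ 2 / (2 * a), half_pos ha, fun x y => ?_⟩
    have h1 := hB x y
    have h2 := c.le_opNorm (x - y)
    rw [Real.norm_eq_abs] at h2
    have h3 := neg_abs_le (c (x - y))
    have h4 : a / 2 * ‖x - y‖ ^ 2 + ‖c‖ ^ 2 / (2 * a) - ‖c‖ * ‖x - y‖ =
        (a * ‖x - y‖ - ‖c‖) ^ 2 / (2 * a) := by
      field_simp
      ring
    have h5 : 0 ≤ (a * ‖x - y‖ - ‖c‖) ^ 2 / (2 * a) := by positivity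
    change _ ≤ S.toFun (x, y) + c (x - y)
    linarith

/-- The linear term telescopes, so `c` does not affect which sequences minimize between fixed ends;
on loops in the class `r` it adds the constant `-c (intVec r)`. -/
theorem action_shift (n : ℕ) (w : ℕ → Config d) :
    action (S.shift c) n w = action S.toFun n w + c (w 0 - w n) := by
  induction n with
  | zero => simp [action]
  | succ n ih =>
    have h1 : ∀ L : Config d × Config d → ℝ, action L (n + 1) w =
        action L n w + L (w n, w (n + 1)) := fun L => Finset.sum_range_succ _ _
    rw [h1, h1, ih]
    simp only [shift, map_sub]
    ring

variable {S}

theorem WithoutConjugatePoints.hasHomogeneousLoops_shift (hS : S.WithoutConjugatePoints) :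
    HasHomogeneousLoops (S.shift c) := by
  intro n hn r
  obtain ⟨M, hM⟩ := hS.exists_isLeast_loop hn r
  refine ⟨M - c (intVec r), fun x => ⟨?_, ?_⟩⟩
  · obtain ⟨w, hw0, hwn, hwa⟩ := (hM x).1
    exact ⟨w, hw0, hwn, by rw [action_shift, hwa, hw0, hwn]; simp [sub_eq_add_neg]⟩
  · rintro _ ⟨w, hw0, hwn, rfl⟩
    have := (hM x).2 ⟨w, hw0, hwn, rfl⟩
    rw [action_shift, hw0, hwn, sub_add_cancel_left, map_neg]
    linarith

end GeneratingFunction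
end TwistMap

theorem lemma5p3 (d : ℕ) (hd : 1 ≤ d) (S : TwistMap.GeneratingFunction d)
    (hS : S.WithoutConjugatePoints) (c : StrongDual ℝ (TwistMap.Config d)) :
    -- the infima that define the minimizing holonomic value and the potential are finite
    TwistMap.holonomicInf (S.shift c) =
        ((TwistMap.minimizingHolonomicValue (S.shift c) : ℝ) : EReal) ∧
      (∀ x y : TwistMap.Config d, IsGLB (TwistMap.connectingActions (S.shift c) x y)
        (TwistMap.manePotential (S.shift c) x y)) ∧
      -- the Aubry set projects onto the whole space
      Prod.fst '' TwistMap.aubrySet (S.shift c) = Set.univ ∧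
      -- the potential is additive and antisymmetric
      (∀ x y z : TwistMap.Config d,
        TwistMap.manePotential (S.shift c) x z =
          TwistMap.manePotential (S.shift c) x y + TwistMap.manePotential (S.shift c) y z) ∧
      (∀ x y : TwistMap.Config d,
        TwistMap.manePotential (S.shift c) x y + TwistMap.manePotential (S.shift c) y x = 0) := by
  have hL := S.isPeriodicCost_shift c
  have hH := hS.hasHomogeneousLoops_shift c
  exact ⟨hL.holonomicInf_eq, hL.isGLB_manePotential, hL.aubry_projects_onto hH,
    hL.manePotential_add hH, hL.manePotential_antisymm hH⟩
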